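/- Work on $\mathbb T=\mathbb R/2\pi\mathbb Z$ with $\widehat f(k)=\frac1{2\pi}\int_{\mathbb T}f(\xi)e^{-ik\xi}\,d\xi$, $\|f\|_{H^s}^2=\sum_{k\in\mathbb Z}(1+k^2)^s|\widehat f(k)|^2$, $\|f\|_{\dot H^s}^2=\sum_{k\ne0}|k|^{2s}|\widehat f(k)|^2$ and $\|f\|_{L^2}=\|f\|_{H^0}$; all functions $F$, $F_0$ are real-valued. Let $\Lambda$, $\mathcal H$ be the Fourier multipliers with symbols $|k|$, $-i\,\mathrm{sgn}(k)$, and write $[\Lambda,f]g=\Lambda(fg)-f\Lambda g$. For $\Upsilon,\delta,\beta,\varepsilon>0$ consider the equation $$F_\tau=\frac1\varepsilon(a+b\mathcal H)\Big((I+\Upsilon\Lambda)F_\xi+\frac\beta4\Lambda F_{\xi\xi\xi}+\delta\Lambda F_{\xi\xi}+\mathcal HF\Big)-(a+b\mathcal H)\big(2F_\xi\Lambda F-[\Lambda,F]F_\xi\big),\qquad F(\cdot,0)=F_0,\qquad(\ast)$$ where $a,b$ are the Fourier multipliers with symbols $$a_k=\frac{2(1+\Upsilon|k|)}{4(1+\Upsilon|k|)^2+\delta^2k^4},\qquad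 b_k=\frac{\delta k^2}{4(1+\Upsilon|k|)^2+\delta^2k^4},\qquad k\in\mathbb Z .$$ A solution of $(\ast)$ on a time interval $I\ni0$ is an $F\in C(I;H^2(\mathbb T))$ that satisfies $F(\cdot,0)=F_0$ and, for every $\tau\in I$, the equation in the sense of periodic distributions in $\xi$ (Fourier mode by Fourier mode). Put $$E[f]:=\|f\|_{L^2}^2+2\Upsilon\|f\|_{\dot H^{1/2}}^2+\Upsilon^2\|f\|_{\dot H^1}^2+\frac{\delta^2}{4}\|f\|_{\dot H^2}^2 .$$ **Theorem.** Let $\Upsilon,\delta,\beta>0$. There are constants $\varepsilon_\ast,c,C,m,M>0$, depending only on $\Upsilon,\delta,\beta$, such that $m\|f\|_{H^2}^2\le E[f]\le M\|f\|_{H^2}^2$ for every $f\in H^2(\mathbb T)$ and the following holds. Let $\varepsilon>0$ and let $F_0\in H^2(\mathbb T)$ have zero mean and satisfy $\varepsilon\|F_0\|_{H^2}\le\varepsilon_\ast$. Then $(\ast)$ has a global solution $F\in C([0,\infty);H^2(\mathbb T))$; for every $T>0$, every solution of $(\ast)$ on $[0,T]$ coincides with $F$ on $[0,T]$; and $$E[F(\tau)]\le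 C\,E[F_0]\,e^{-c\tau/\varepsilon}\qquad\text{for all }\tau\ge0 .$$ In particular, for $0<\varepsilon\le1$ the conclusion holds whenever $\|F_0\|_{H^2}\le\varepsilon_\ast$, with $E[F(\tau)]\le C\,E[F_0]\,e^{-c\tau}$. -/

import Mathlib

noncomputable section

namespace HydroUni

open MeasureTheory AddCircle Filter Topology
open scoped Real

instance instFactTwoPiPos : Fact (0 < 2 * π) := ⟨Real.two_pi_pos⟩

/-- The one-dimensional torus of length `2π`. -/
abbrev Torus : Type := AddCircle (2 * π)

/-- Real-valued square integrable functions on the torus (classes modulo null sets), with respect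
to the normalized measure `dξ / (2π)`. -/
abbrev L2 : Type := Lp ℝ 2 (haarAddCircle : Measure Torus)

/-- A real `L²` function, viewed as a complex-valued function. -/
def toC (f : L2) : Torus → ℂ := fun x => ((f x : ℝ) : ℂ)

/-- Fourier coefficients `(2π)⁻¹ ∫ f(ξ) e^{-ikξ} dξ`. -/
def coeff (f : L2) (k : ℤ) : ℂ := fourierCoeff (toC f) k

/-! ### Sobolev spaces -/

/-- `f ∈ H^s(𝕋)`. -/
def MemH (s : ℝ) (f : L2) : Prop :=
  Summable fun k : ℤ => (1 + (k : ℝ) ^ 2) ^ s * ‖coeff f k‖ ^ 2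

/-- The norm of `H^s(𝕋)`, meaningful on functions with `MemH s f`. -/
def normH (s : ℝ) (f : L2) : ℝ :=
  Real.sqrt (∑' k : ℤ, (1 + (k : ℝ) ^ 2) ^ s * ‖coeff f k‖ ^ 2)

/-- The homogeneous seminorm of `H^s(𝕋)`, meaningful on functions with `MemH s f`. -/
def seminormH (s : ℝ) (f : L2) : ℝ :=
  Real.sqrt (∑' k : ℤ, if k = 0 then 0 else |(k : ℝ)| ^ (2 * s) * ‖coeff f k‖ ^ 2)

/-- Zero spatial mean. -/
def MeanZero (f : L2) : Prop := ∫ x, f x ∂(haarAddCircle : Measure Torus) = 0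

/-- The energy
`‖f‖²_{L²} + 2Υ‖f‖²_{Ḣ^{1/2}} + Υ²‖f‖²_{Ḣ¹} + (δ²/4)‖f‖²_{Ḣ²}`. -/
def energy (Υ δ : ℝ) (f : L2) : ℝ :=
  ‖f‖ ^ 2 + 2 * Υ * seminormH (1 / 2) f ^ 2 + Υ ^ 2 * seminormH 1 f ^ 2
    + δ ^ 2 / 4 * seminormH 2 f ^ 2

/-! ### Fourier multipliers -/

open Classical in
/-- The `L²` function with prescribed Fourier coefficients, if these are square summable
(and `0` otherwise). -/
def ofCoeff (u : ℤ → ℂ) : Torus → ℂ :=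
  if h : Memℓp u 2 then
    ((fourierBasis (T := 2 * π)).repr.symm (⟨u, h⟩ : lp (fun _ : ℤ => ℂ) 2) :
      Lp ℂ 2 (haarAddCircle : Measure Torus))
  else 0

/-- The (unbounded) Fourier multiplier with symbol `m` on `L²`; its domain consists of the `f` for
which `m(k) f̂(k)` is square summable. -/
def multiplier (m : ℤ → ℂ) (f : Torus → ℂ) : Torus → ℂ :=
  ofCoeff fun k => m k * fourierCoeff f k

/-- Symbol of `∂_ξ`. -/
def symD (k : ℤ) : ℂ := Complex.I * (k : ℂ)

/-- Symbol of `Λ = |∂_ξ|`. -/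
def symLam (k : ℤ) : ℂ := ((|(k : ℝ)| : ℝ) : ℂ)

/-- Symbol of the Hilbert transform. -/
def symHilb (k : ℤ) : ℂ := -Complex.I * ((k.sign : ℤ) : ℂ)

/-- Symbol of `a = 2(I+ΥΛ) / (4(I+ΥΛ)² - δ²Λ²∂_ξ²)`. -/
def symA (Υ δ : ℝ) (k : ℤ) : ℂ :=
  2 * (1 + Υ * symLam k)
    / (4 * (1 + Υ * symLam k) ^ 2 - (δ : ℂ) ^ 2 * symLam k ^ 2 * symD k ^ 2)

/-- Symbol of `b = δΛ² / (4(I+ΥΛ)² - δ²Λ²∂_ξ²)`. -/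
def symB (Υ δ : ℝ) (k : ℤ) : ℂ :=
  (δ : ℂ) * symLam k ^ 2
    / (4 * (1 + Υ * symLam k) ^ 2 - (δ : ℂ) ^ 2 * symLam k ^ 2 * symD k ^ 2)

/-- Symbol of `a + b𝓗`. -/
def symAB (Υ δ : ℝ) (k : ℤ) : ℂ := symA Υ δ k + symB Υ δ k * symHilb k

/-- Symbol of `(I+ΥΛ)∂_ξ + (β/4)Λ∂_ξ³ + δΛ∂_ξ² + 𝓗`. -/
def symLin (Υ δ β : ℝ) (k : ℤ) : ℂ :=
  (1 + Υ * symLam k) * symD k + (β : ℂ) / 4 * symLam k * symD k ^ 3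
    + (δ : ℂ) * symLam k * symD k ^ 2 + symHilb k

/-- The derivative `∂_ξ` (in the weak sense). -/
def deriv1 (f : Torus → ℂ) : Torus → ℂ := multiplier symD f

/-- The operator `Λ`. -/
def Lam (f : Torus → ℂ) : Torus → ℂ := multiplier symLam f

/-- The commutator `[A, f] g = A (f g) - f A g`. -/
def comm (A : (Torus → ℂ) → (Torus → ℂ)) (f g : Torus → ℂ) : Torus → ℂ :=
  A (f * g) - f * A g

/-- The quadratic term `2 f_ξ Λf - [Λ, f] f_ξ`. -/
def nonlin (f : Torus → ℂ) : Torus → ℂ :=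
  (2 : ℂ) • (deriv1 f * Lam f) - comm Lam f (deriv1 f)

/-! ### The evolution equation -/

/-- The `k`-th Fourier coefficient of
`ε⁻¹ (a + b𝓗) ((I+ΥΛ)f_ξ + (β/4)Λf_ξξξ + δΛf_ξξ + 𝓗f) - (a + b𝓗) (2 f_ξ Λf - [Λ, f] f_ξ)`,
a periodic distribution for `f ∈ H²`. -/
def rhsCoeff (Υ δ β ε : ℝ) (f : L2) (k : ℤ) : ℂ :=
  1 / (ε : ℂ) * (symAB Υ δ k * (symLin Υ δ β k * coeff f k))
    - symAB Υ δ k * fourierCoeff (nonlin (toC f)) k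

/-- `F ∈ C(I; H²(𝕋))`. -/
def ContH2On (I : Set ℝ) (F : ℝ → L2) : Prop :=
  (∀ τ ∈ I, MemH 2 (F τ)) ∧
    ∀ τ₀ ∈ I, Tendsto (fun τ => normH 2 (F τ - F τ₀)) (𝓝[I] τ₀) (𝓝 0)

/-- `F ∈ C(I; H²(𝕋))` solves the equation on the time interval `I ∋ 0`, with initial datum `F₀`.
The equation is an equality of periodic distributions in `ξ` at each time, that is, an equality of
all Fourier coefficients. -/
structure IsSolution (Υ δ β ε : ℝ) (I : Set ℝ) (F₀ : L2) (F : ℝ → L2) : Prop where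
  cont : ContH2On I F
  init : F 0 = F₀
  eqn : ∀ τ ∈ I, ∀ k : ℤ,
    HasDerivWithinAt (fun σ => coeff (F σ) k) (rhsCoeff Υ δ β ε (F τ) k) I τ

end HydroUni

end

/-!
In the coordinates `x_k = (1 + k²) f̂(k)` the space `H²` is `ℓ²(ℤ)`, and the equation reads, mode by
mode, `x_k' = ε⁻¹ λ_k x_k + B(x, x)_k`, where `λ_k` is the product of the symbols of `a + b𝓗` and of
the linear operator.

*Linear part.* With `D_k = 4(1 + Υ|k|)² + δ²k⁴`, a direct computation (`re_symAB_mul_symLin`) gives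
`Re λ_k = -δk²((1 + Υ|k|)|k| + βk⁴/4 + 1) / D_k` for `k ≠ 0`, which is at most a negative constant,
while `λ_0 = 0`. The diagonal semigroup `e^{tλ}` is thus a contraction on `ℓ²(ℤ)` that decays
exponentially on states of zero mean.

*Quadratic part.* The Fourier coefficients of `2 f_ξ Λf - [Λ, f] f_ξ` are the convolution sums
`∑_j q(k, j) f̂(j) f̂(k - j)` with `q(k, j) = ij(2|k - j| - |k| + |j|)`
(`hasSum_fourierCoeff_nonlin`). Since `||j| - |k|| ≤ |k - j|`, one has `|q(k, j)| ≤ 3|j||k - j|`,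
and since `a + b𝓗` gains two derivatives (`norm_japaneseSq_mul_symAB_le`), `B` is a bounded bilinear map on `ℓ²(ℤ)`
(`exists_hasSum_stateKernel`). The kernel `q(0, j)` is odd in `j`, so the mean is conserved
(`quadratic_apply_zero`).

The equation is therefore a semilinear one with a bounded quadratic nonlinearity. Duhamel's formula
for `w(t) = e^{γt} x(t)` is a contraction on a ball of the bounded continuous functions of time when
`ε‖F₀‖` is small (`exists_modes_of_small`), which yields existence and decay. Grönwall's inequality
yields uniqueness (`eq_of_modes`); uniqueness also shows that the solution found among complex
sequences is real, because its reflection `k ↦ conj x_{-k}` solves the same equation. Finally the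
energy is the quadratic form with symbol `D_k / 4`, which is comparable to `(1 + k²)²`
(`le_energy`, `energy_le`), so the decay in `H²` is the decay of the energy.
-/

noncomputable section

namespace HydroUni

open MeasureTheory AddCircle Filter Topology
open scoped Real ComplexConjugate BoundedContinuousFunction

/-! ### The sequence space and its operators -/

/-- The Hilbert space `ℓ²(ℤ; ℂ)`. -/
abbrev Seq : Type := lp (fun _ : ℤ => ℂ) 2

theorem memℓp_two_iff {f : ℤ → ℂ} : Memℓp f 2 ↔ Summable fun k => ‖f k‖ ^ 2 := by
  rw [memℓp_gen_iff (by norm_num)]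
  simp

theorem Seq.summable_sq (x : Seq) : Summable fun k => ‖x k‖ ^ 2 :=
  memℓp_two_iff.1 (lp.memℓp x)

theorem Seq.norm_sq (x : Seq) : ‖x‖ ^ 2 = ∑' k, ‖x k‖ ^ 2 := by
  have := lp.norm_rpow_eq_tsum (p := 2) (by norm_num) x
  simpa using this

/-- A square summable sequence, as an element of `ℓ²(ℤ)`. -/
def Seq.mk (f : ℤ → ℂ) (hf : Summable fun k => ‖f k‖ ^ 2) : Seq := ⟨f, memℓp_two_iff.2 hf⟩

@[simp]
theorem Seq.mk_apply (f : ℤ → ℂ) (hf : Summable fun k => ‖f k‖ ^ 2) (k : ℤ) :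
    Seq.mk f hf k = f k := rfl

theorem Seq.ext {x y : Seq} (h : ∀ k, x k = y k) : x = y := lp.ext (funext h)

theorem Seq.add_apply (x y : Seq) (k : ℤ) : (x + y) k = x k + y k := rfl

theorem Seq.sub_apply (x y : Seq) (k : ℤ) : (x - y) k = x k - y k := rfl

theorem Seq.smul_apply (c : ℂ) (x : Seq) (k : ℤ) : (c • x) k = c * x k := rfl

theorem Seq.continuous_apply (k : ℤ) : Continuous fun x : Seq => x k :=
  (lp.evalCLM ℂ (fun _ : ℤ => ℂ) 2 k).continuous

theorem summable_weightedShift {m : ℤ → ℂ} {M : ℝ} (hm : ∀ k, ‖m k‖ ≤ M) (j : ℤ) (x : Seq) :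
    Summable fun k => ‖m k * x (k - j)‖ ^ 2 := by
  have h : Summable fun k => M ^ 2 * ‖x (k - j)‖ ^ 2 :=
    ((Equiv.subRight j).summable_iff.2 x.summable_sq).mul_left _
  refine h.of_nonneg_of_le (fun k => by positivity) fun k => ?_
  rw [norm_mul, mul_pow]
  gcongr
  exact hm k

/-- The linear map underlying `weightedShift`. -/
def weightedShiftₗ (m : ℤ → ℂ) (M : ℝ) (hm : ∀ k, ‖m k‖ ≤ M) (j : ℤ) : Seq →ₗ[ℂ] Seq where
  toFun x := Seq.mk _ (summable_weightedShift hm j x)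
  map_add' x y := Seq.ext fun k => by
    rw [Seq.mk_apply, Seq.add_apply, Seq.add_apply, Seq.mk_apply, Seq.mk_apply, mul_add]
  map_smul' c x := Seq.ext fun k => by
    rw [Seq.mk_apply, Seq.smul_apply, RingHom.id_apply, Seq.smul_apply, Seq.mk_apply,
      mul_left_comm]

theorem norm_weightedShiftₗ_le (m : ℤ → ℂ) (M : ℝ) (hm : ∀ k, ‖m k‖ ≤ M) (j : ℤ) (x : Seq) :
    ‖weightedShiftₗ m M hm j x‖ ≤ M * ‖x‖ := by
  have hM : 0 ≤ M := (norm_nonneg _).trans (hm 0)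
  have h : Summable fun k => ‖x (k - j)‖ ^ 2 := (Equiv.subRight j).summable_iff.2 x.summable_sq
  have h2 : ‖x‖ ^ 2 = ∑' k, ‖x (k - j)‖ ^ 2 :=
    x.norm_sq.trans ((Equiv.subRight j).tsum_eq fun k => ‖x k‖ ^ 2).symm
  refine abs_le_of_sq_le_sq' ?_ (by positivity) |>.2
  rw [mul_pow, h2, ← tsum_mul_left, Seq.norm_sq]
  refine Summable.tsum_le_tsum (fun k => ?_) (summable_weightedShift hm j x) (h.mul_left _)
  change ‖m k * x (k - j)‖ ^ 2 ≤ _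
  rw [norm_mul, mul_pow]
  gcongr
  exact hm k

/-- The operator `(x_k) ↦ (m_k x_{k-j})` on `ℓ²(ℤ)` for a bounded weight `m`. -/
def weightedShift (m : ℤ → ℂ) (M : ℝ) (hm : ∀ k, ‖m k‖ ≤ M) (j : ℤ) : Seq →L[ℂ] Seq :=
  LinearMap.mkContinuous (weightedShiftₗ m M hm j) M (norm_weightedShiftₗ_le m M hm j)

theorem weightedShift_apply (m : ℤ → ℂ) (M : ℝ) (hm : ∀ k, ‖m k‖ ≤ M) (j : ℤ) (x : Seq) (k : ℤ) :
    weightedShift m M hm j x k = m k * x (k - j) := rfl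

theorem norm_weightedShift_le (m : ℤ → ℂ) (M : ℝ) (hm : ∀ k, ‖m k‖ ≤ M) (j : ℤ) :
    ‖weightedShift m M hm j‖ ≤ M :=
  LinearMap.mkContinuous_norm_le _ ((norm_nonneg _).trans (hm 0)) _

section Bilinear

variable {κ : ℤ → ℤ → ℂ} {p : ℤ → ℝ}

theorem summable_mul_of_sq (hp : Summable fun j => p j ^ 2) (x : Seq) :
    Summable fun j => ‖x j‖ * p j := by
  refine Summable.of_norm_bounded (x.summable_sq.add hp) fun j => ?_
  rw [Real.norm_eq_abs, abs_le]
  constructor <;> nlinarith [sq_nonneg (‖x j‖ - p j), sq_nonneg (‖x j‖ + p j)]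

theorem norm_smul_weightedShift_le (hκ : ∀ j k, ‖κ k j‖ ≤ p j) (x : Seq) (j : ℤ) :
    ‖x j • weightedShift (κ · j) (p j) (hκ j) j‖ ≤ ‖x j‖ * p j := by
  rw [norm_smul]
  gcongr
  exact norm_weightedShift_le _ _ _ _

theorem summable_smul_weightedShift (hκ : ∀ j k, ‖κ k j‖ ≤ p j) (hp : Summable fun j => p j ^ 2)
    (x : Seq) : Summable fun j => x j • weightedShift (κ · j) (p j) (hκ j) j :=
  .of_norm_bounded (summable_mul_of_sq hp x) (norm_smul_weightedShift_le hκ x)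

/-- The operator `B(x, ·) = ∑_j x_j • weightedShift_j` underlying `bilin`. -/
def bilinₗ (κ : ℤ → ℤ → ℂ) (p : ℤ → ℝ) (hκ : ∀ j k, ‖κ k j‖ ≤ p j)
    (hp : Summable fun j => p j ^ 2) : Seq →ₗ[ℂ] Seq →L[ℂ] Seq where
  toFun x := ∑' j, x j • weightedShift (κ · j) (p j) (hκ j) j
  map_add' x y := by
    rw [← (summable_smul_weightedShift hκ hp x).tsum_add (summable_smul_weightedShift hκ hp y)]
    exact tsum_congr fun j => add_smul _ _ _
  map_smul' c x := by
    rw [RingHom.id_apply, ← (summable_smul_weightedShift hκ hp x).tsum_const_smul]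
    exact tsum_congr fun j => mul_smul _ _ _

theorem norm_bilinₗ_le (hκ : ∀ j k, ‖κ k j‖ ≤ p j) (hp : Summable fun j => p j ^ 2) (x : Seq) :
    ‖bilinₗ κ p hκ hp x‖ ≤ Real.sqrt (∑' j, p j ^ 2) * ‖x‖ := by
  have h := summable_mul_of_sq hp x
  have h1 : ‖bilinₗ κ p hκ hp x‖ ≤ ∑' j, ‖x j‖ * p j :=
    tsum_of_norm_bounded h.hasSum (norm_smul_weightedShift_le hκ x)
  refine h1.trans ?_
  have hp0 : ∀ j, 0 ≤ p j := fun j => (norm_nonneg _).trans (hκ j 0)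
  have := Real.inner_le_Lp_mul_Lq_tsum_of_nonneg (p := 2) (q := 2)
    (by rw [Real.holderConjugate_iff]; norm_num) (f := fun j => ‖x j‖) (g := p)
    (fun j => norm_nonneg _) hp0 (by simpa using x.summable_sq) (by simpa using hp)
  refine this.trans (le_of_eq ?_)
  rw [mul_comm, ← Real.sqrt_eq_rpow, ← Real.sqrt_eq_rpow, ← Real.sqrt_sq (norm_nonneg x),
    Seq.norm_sq]
  simp only [Real.rpow_ofNat]

/-- The bilinear map `B(x, y)_k = ∑_j κ(k, j) x_j y_{k-j}` on `ℓ²(ℤ)`, for a kernel dominated by a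
square summable sequence in `j`. It is the absolutely convergent series
`B(x, ·) = ∑_j x_j • weightedShift_j` of operators, which makes its boundedness a case of the
Cauchy–Schwarz inequality. -/
def bilin (κ : ℤ → ℤ → ℂ) (p : ℤ → ℝ) (hκ : ∀ j k, ‖κ k j‖ ≤ p j)
    (hp : Summable fun j => p j ^ 2) : Seq →L[ℂ] Seq →L[ℂ] Seq :=
  LinearMap.mkContinuous (bilinₗ κ p hκ hp) (Real.sqrt (∑' j, p j ^ 2)) (norm_bilinₗ_le hκ hp)

theorem hasSum_bilin (hκ : ∀ j k, ‖κ k j‖ ≤ p j) (hp : Summable fun j => p j ^ 2) (x y : Seq)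
    (k : ℤ) : HasSum (fun j => κ k j * x j * y (k - j)) (bilin κ p hκ hp x y k) := by
  have h := (summable_smul_weightedShift hκ hp x).hasSum
  have h1 := (ContinuousLinearMap.apply ℂ Seq y).hasSum h
  have h2 := (lp.evalCLM ℂ (fun _ : ℤ => ℂ) 2 k).hasSum h1
  have h3 : (fun j => κ k j * x j * y (k - j)) = fun j => x j * (κ k j * y (k - j)) := by
    funext j
    ring
  rw [h3]
  exact h2

end Bilinear

/-! ### Diagonal contraction semigroups -/

theorem norm_exp_mul_max_le {z : ℂ} {γ : ℝ} (hz : z.re ≤ -γ) (t : ℝ) :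
    ‖Complex.exp (z * ((max t 0 : ℝ) : ℂ))‖ ≤ Real.exp (-γ * max t 0) := by
  rw [Complex.norm_exp, Complex.re_mul_ofReal]
  gcongr

/-- The semigroup `e^{tν}` of a diagonal operator with `Re ν_k ≤ -γ`. It is extended by the
identity to negative times, which makes it a function on all of `ℝ`. -/
def diagExp (ν : ℤ → ℂ) (γ : ℝ) (hν : ∀ k, (ν k).re ≤ -γ) (t : ℝ) : Seq →L[ℂ] Seq :=
  weightedShift (fun k => Complex.exp (ν k * ((max t 0 : ℝ) : ℂ))) (Real.exp (-γ * max t 0))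
    (fun k => norm_exp_mul_max_le (hν k) t) 0

section Semigroup

variable {ν : ℤ → ℂ} {γ : ℝ} (hν : ∀ k, (ν k).re ≤ -γ)

theorem diagExp_apply (t : ℝ) (x : Seq) (k : ℤ) :
    diagExp ν γ hν t x k = Complex.exp (ν k * ((max t 0 : ℝ) : ℂ)) * x k := by
  rw [diagExp, weightedShift_apply, sub_zero]

theorem norm_diagExp_le (t : ℝ) : ‖diagExp ν γ hν t‖ ≤ Real.exp (-γ * max t 0) :=
  norm_weightedShift_le _ _ _ _

theorem norm_diagExp_le_one (hγ : 0 ≤ γ) (t : ℝ) : ‖diagExp ν γ hν t‖ ≤ 1 := by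
  refine (norm_diagExp_le hν t).trans (Real.exp_le_one_iff.2 ?_)
  have : 0 ≤ γ * max t 0 := by positivity
  linarith

theorem continuous_diagExp_apply (hγ : 0 ≤ γ) (x : Seq) :
    Continuous fun t => diagExp ν γ hν t x := by
  rw [continuous_iff_continuousAt]
  intro t₀
  have h1 : ∀ t k, ‖Complex.exp (ν k * ((max t 0 : ℝ) : ℂ))‖ ≤ 1 := fun t k =>
    (norm_exp_mul_max_le (((hν k).trans (neg_nonpos.2 hγ)).trans_eq neg_zero.symm) t).trans
      (by simp)
  have h2 : ∀ t k, (diagExp ν γ hν t x - diagExp ν γ hν t₀ x) k =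
      (Complex.exp (ν k * ((max t 0 : ℝ) : ℂ)) - Complex.exp (ν k * ((max t₀ 0 : ℝ) : ℂ))) * x k :=
    fun t k => by rw [Seq.sub_apply, diagExp_apply, diagExp_apply, sub_mul]
  have h : Tendsto (fun t => ‖diagExp ν γ hν t x - diagExp ν γ hν t₀ x‖ ^ 2) (𝓝 t₀) (𝓝 0) := by
    simp only [Seq.norm_sq, h2]
    suffices H : Tendsto (fun t => ∑' k, ‖(Complex.exp (ν k * ((max t 0 : ℝ) : ℂ)) -
        Complex.exp (ν k * ((max t₀ 0 : ℝ) : ℂ))) * x k‖ ^ 2) (𝓝 t₀) (𝓝 (∑' _ : ℤ, (0 : ℝ))) by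
      rwa [tsum_zero] at H
    refine tendsto_tsum_of_dominated_convergence (x.summable_sq.mul_left 4) (fun k => ?_)
      (.of_forall fun t k => ?_)
    · have : Continuous fun t => ‖(Complex.exp (ν k * ((max t 0 : ℝ) : ℂ)) -
          Complex.exp (ν k * ((max t₀ 0 : ℝ) : ℂ))) * x k‖ ^ 2 := by fun_prop
      simpa using this.tendsto t₀
    · have h3 := (norm_sub_le _ _).trans (add_le_add (h1 t k) (h1 t₀ k))
      rw [norm_pow, norm_norm, norm_mul, mul_pow]
      gcongr
      nlinarith [norm_nonneg (Complex.exp (ν k * ((max t 0 : ℝ) : ℂ)) -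
        Complex.exp (ν k * ((max t₀ 0 : ℝ) : ℂ)))]
  rw [ContinuousAt, tendsto_iff_norm_sub_tendsto_zero]
  simpa using h.sqrt

theorem continuous_diagExp (hγ : 0 ≤ γ) :
    Continuous fun q : ℝ × Seq => diagExp ν γ hν q.1 q.2 := by
  rw [continuous_iff_continuousAt]
  rintro ⟨t₀, x₀⟩
  rw [ContinuousAt, tendsto_iff_norm_sub_tendsto_zero]
  have h1 : Tendsto (fun q : ℝ × Seq => ‖q.2 - x₀‖ +
      ‖diagExp ν γ hν q.1 x₀ - diagExp ν γ hν t₀ x₀‖) (𝓝 (t₀, x₀)) (𝓝 0) := by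
    have : Continuous (fun q : ℝ × Seq => ‖q.2 - x₀‖ +
        ‖diagExp ν γ hν q.1 x₀ - diagExp ν γ hν t₀ x₀‖) := by
      have := (continuous_diagExp_apply hν hγ x₀).comp (continuous_fst (X := ℝ) (Y := Seq))
      simp only [Function.comp_def] at this
      fun_prop
    simpa using this.tendsto (t₀, x₀)
  refine squeeze_zero (fun _ => norm_nonneg _) (fun q => ?_) h1
  calc ‖diagExp ν γ hν q.1 q.2 - diagExp ν γ hν t₀ x₀‖
      = ‖diagExp ν γ hν q.1 (q.2 - x₀) + (diagExp ν γ hν q.1 x₀ - diagExp ν γ hν t₀ x₀)‖ := by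
        rw [map_sub]; abel_nf
    _ ≤ _ := norm_add_le _ _
    _ ≤ _ := by
        gcongr
        simpa using (diagExp ν γ hν q.1).le_of_opNorm_le (norm_diagExp_le_one hν hγ _) (q.2 - x₀)

end Semigroup

/-! ### The Duhamel integral -/

section Duhamel

variable {ν : ℤ → ℂ} {γ : ℝ} (hν : ∀ k, (ν k).re ≤ -γ)

/-- The Duhamel integral `∫₀ᵗ e^{(t-s)ν} h(s) ds`, meaningful for `t ≥ 0`. -/
def duhamel (h : ℝ → Seq) (t : ℝ) : Seq := ∫ s in (0 : ℝ)..t, diagExp ν γ hν (t - s) (h s)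

theorem continuous_duhamel_integrand (hγ : 0 ≤ γ) {h : ℝ → Seq} (hh : Continuous h) :
    Continuous fun q : ℝ × ℝ => diagExp ν γ hν (q.1 - q.2) (h q.2) :=
  (continuous_diagExp hν hγ).comp
    ((continuous_fst.sub continuous_snd).prodMk (hh.comp continuous_snd))

theorem intervalIntegrable_duhamel (hγ : 0 ≤ γ) {h : ℝ → Seq} (hh : Continuous h) (t : ℝ) :
    IntervalIntegrable (fun s => diagExp ν γ hν (t - s) (h s)) volume 0 t :=
  ((continuous_duhamel_integrand hν hγ hh).comp
    (continuous_const.prodMk continuous_id)).intervalIntegrable _ _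

theorem continuous_duhamel (hγ : 0 ≤ γ) {h : ℝ → Seq} (hh : Continuous h) :
    Continuous (duhamel hν h) :=
  intervalIntegral.continuous_parametric_intervalIntegral_of_continuous
    (continuous_duhamel_integrand hν hγ hh) continuous_id

theorem duhamel_sub (hγ : 0 ≤ γ) {g h : ℝ → Seq} (hg : Continuous g) (hh : Continuous h) (t : ℝ) :
    duhamel hν (fun s => g s - h s) t = duhamel hν g t - duhamel hν h t := by
  simp only [duhamel, map_sub]
  exact intervalIntegral.integral_sub (intervalIntegrable_duhamel hν hγ hg t)
    (intervalIntegrable_duhamel hν hγ hh t)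

theorem duhamel_apply (hγ : 0 ≤ γ) {h : ℝ → Seq} (hh : Continuous h) {t : ℝ} (ht : 0 ≤ t) (k : ℤ) :
    duhamel hν h t k = ∫ s in (0 : ℝ)..t, Complex.exp (ν k * ((t - s : ℝ) : ℂ)) * h s k := by
  have h1 := (lp.evalCLM ℂ (fun _ : ℤ => ℂ) 2 k).intervalIntegral_comp_comm
    (intervalIntegrable_duhamel hν hγ hh t)
  refine h1.symm.trans (intervalIntegral.integral_congr fun s hs => ?_)
  rw [Set.uIcc_of_le ht] at hs
  change diagExp ν γ hν (t - s) (h s) k = _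
  rw [diagExp_apply, max_eq_left (sub_nonneg.2 hs.2)]

theorem norm_duhamel_le_integral (hγ : 0 ≤ γ) {h : ℝ → Seq} (hh : Continuous h) {t : ℝ}
    (ht : 0 ≤ t) : ‖duhamel hν h t‖ ≤ ∫ s in (0 : ℝ)..t, ‖h s‖ := by
  refine intervalIntegral.norm_integral_le_of_norm_le ht (.of_forall fun s _ => ?_)
    (hh.norm.intervalIntegrable _ _)
  simpa using (diagExp ν γ hν (t - s)).le_of_opNorm_le (norm_diagExp_le_one hν hγ _) (h s)

theorem norm_duhamel_le (hγ : 0 < γ) {h : ℝ → Seq} {C : ℝ} (hC : ∀ s, ‖h s‖ ≤ C) {t : ℝ}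
    (ht : 0 ≤ t) : ‖duhamel hν h t‖ ≤ C / γ := by
  have hC0 : 0 ≤ C := (norm_nonneg _).trans (hC 0)
  have hd : ∀ s ∈ Set.uIcc 0 t, HasDerivAt (fun s => C / γ * Real.exp (-γ * (t - s)))
      (C * Real.exp (-γ * (t - s))) s := fun s _ => by
    have h1 : HasDerivAt (fun s => -γ * (t - s)) γ s := by
      simpa using ((hasDerivAt_id s).const_sub t).const_mul (-γ)
    refine (h1.exp.const_mul (C / γ)).congr_deriv ?_
    field_simp
  have hi : IntervalIntegrable (fun s => C * Real.exp (-γ * (t - s))) volume 0 t :=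
    Continuous.intervalIntegrable (by fun_prop) _ _
  have h2 : ‖duhamel hν h t‖ ≤ ∫ s in (0 : ℝ)..t, C * Real.exp (-γ * (t - s)) := by
    refine intervalIntegral.norm_integral_le_of_norm_le ht (.of_forall fun s hs => ?_) hi
    have h3 := norm_diagExp_le hν (t - s)
    rw [max_eq_left (sub_nonneg.2 hs.2)] at h3
    rw [mul_comm C]
    exact (diagExp ν γ hν (t - s)).le_of_opNorm_le_of_le h3 (hC s)
  rw [intervalIntegral.integral_eq_sub_of_hasDerivAt hd hi] at h2
  refine h2.trans ?_
  have : 0 ≤ C / γ * Real.exp (-γ * (t - 0)) := by positivity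
  simp only [sub_self, mul_zero, Real.exp_zero, mul_one]
  linarith

end Duhamel

/-! ### Scalar linear equations -/

theorem exp_duhamel_eq (z₀ ν : ℂ) (g : ℝ → ℂ) (t : ℝ) :
    Complex.exp (ν * (t : ℂ)) * z₀ + ∫ s in (0 : ℝ)..t, Complex.exp (ν * ((t - s : ℝ) : ℂ)) * g s =
      Complex.exp (ν * (t : ℂ)) * (z₀ + ∫ s in (0 : ℝ)..t, Complex.exp (-(ν * (s : ℂ))) * g s) := by
  rw [mul_add, ← intervalIntegral.integral_const_mul]
  congr 1
  refine intervalIntegral.integral_congr fun s _ => ?_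
  change _ = Complex.exp (ν * (t : ℂ)) * (Complex.exp (-(ν * (s : ℂ))) * g s)
  rw [← mul_assoc, ← Complex.exp_add]
  congr 2
  push_cast
  ring

theorem hasDerivAt_exp_mul_ofReal (ν : ℂ) (t : ℝ) :
    HasDerivAt (fun t : ℝ => Complex.exp (ν * (t : ℂ))) (ν * Complex.exp (ν * (t : ℂ))) t := by
  have h1 : HasDerivAt (fun t : ℝ => ν * (t : ℂ)) ν t := by
    simpa using (Complex.ofRealCLM.hasDerivAt (x := t)).const_mul ν
  simpa [mul_comm] using h1.cexp

theorem hasDerivAt_exp_duhamel (z₀ ν : ℂ) {g : ℝ → ℂ} (hg : Continuous g) (t : ℝ) :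
    HasDerivAt (fun t : ℝ => Complex.exp (ν * (t : ℂ)) * z₀ +
        ∫ s in (0 : ℝ)..t, Complex.exp (ν * ((t - s : ℝ) : ℂ)) * g s)
      (ν * (Complex.exp (ν * (t : ℂ)) * z₀ +
        ∫ s in (0 : ℝ)..t, Complex.exp (ν * ((t - s : ℝ) : ℂ)) * g s) + g t) t := by
  have hc : Continuous fun s : ℝ => Complex.exp (-(ν * (s : ℂ))) * g s := by fun_prop
  have h1 := (hasDerivAt_exp_mul_ofReal ν t).mul
    ((intervalIntegral.integral_hasDerivAt_right (hc.intervalIntegrable 0 t)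
      (hc.stronglyMeasurableAtFilter _ _) hc.continuousAt).const_add z₀)
  simp only [exp_duhamel_eq]
  refine h1.congr_deriv ?_
  rw [← mul_assoc (Complex.exp (ν * (t : ℂ))), ← Complex.exp_add, add_neg_cancel, Complex.exp_zero]
  ring

theorem eq_duhamel_of_hasDerivWithinAt {ν : ℂ} {g z : ℝ → ℂ} (hg : Continuous g) {T : ℝ}
    (hz : ∀ t ∈ Set.Icc 0 T, HasDerivWithinAt z (ν * z t + g t) (Set.Icc 0 T) t)
    {t : ℝ} (ht : t ∈ Set.Icc 0 T) :
    z t = Complex.exp (ν * (t : ℂ)) * z 0 +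
      ∫ s in (0 : ℝ)..t, Complex.exp (ν * ((t - s : ℝ) : ℂ)) * g s := by
  have hd : ∀ s ∈ Set.Icc 0 T, HasDerivWithinAt (fun s : ℝ => Complex.exp (-ν * (s : ℂ)) * z s)
      (Complex.exp (-(ν * (s : ℂ))) * g s) (Set.Icc 0 T) s := fun s hs => by
    refine ((hasDerivAt_exp_mul_ofReal (-ν) s).hasDerivWithinAt.mul (hz s hs)).congr_deriv ?_
    simp only [neg_mul]
    ring
  have hc : Continuous fun s : ℝ => Complex.exp (-(ν * (s : ℂ))) * g s := by fun_prop
  have hsub : Set.Icc 0 t ⊆ Set.Icc 0 T := Set.Icc_subset_Icc_right ht.2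
  have h1 := intervalIntegral.integral_eq_sub_of_hasDerivAt_of_le ht.1
    (fun s hs => ((hd s (hsub hs)).continuousWithinAt).mono hsub)
    (fun s hs => (hd s (hsub ⟨hs.1.le, hs.2.le⟩)).hasDerivAt
      (Icc_mem_nhds hs.1 (hs.2.trans_le ht.2))) (hc.intervalIntegrable 0 t)
  rw [exp_duhamel_eq, h1]
  simp only [Complex.ofReal_zero, mul_zero, Complex.exp_zero, one_mul, add_sub_cancel]
  rw [← mul_assoc, ← Complex.exp_add]
  simp

/-! ### Quadratic perturbations of diagonal semigroups -/

section Quadratic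

variable (B : Seq →L[ℂ] Seq →L[ℂ] Seq)

theorem norm_quadratic_le (x : Seq) : ‖B x x‖ ≤ ‖B‖ * ‖x‖ ^ 2 := by
  rw [pow_two, ← mul_assoc]
  exact B.le_opNorm₂ x x

theorem norm_quadratic_sub_le (x y : Seq) :
    ‖B x x - B y y‖ ≤ ‖B‖ * (‖x‖ + ‖y‖) * ‖x - y‖ := by
  have h : B x x - B y y = B (x - y) x + B y (x - y) := by
    simp
  rw [h]
  calc _ ≤ _ := norm_add_le _ _
    _ ≤ ‖B‖ * ‖x - y‖ * ‖x‖ + ‖B‖ * ‖y‖ * ‖x - y‖ :=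
      add_le_add (B.le_opNorm₂ _ _) (B.le_opNorm₂ _ _)
    _ = _ := by ring

theorem continuous_quadratic {u : ℝ → Seq} (hu : Continuous u) :
    Continuous fun t => B (u t) (u t) :=
  (B.continuous.comp hu).clm_apply hu

/-- Uniqueness for `x' = μ x + B(x, x)`, the equation being imposed on each mode: the difference of
two solutions is a Duhamel integral, to which Grönwall's inequality applies. -/
theorem eq_of_modes {μ : ℤ → ℂ} (hμ : ∀ k, (μ k).re ≤ 0) {T : ℝ} (hT : 0 ≤ T) {u v : ℝ → Seq}
    (hu : ContinuousOn u (Set.Icc 0 T)) (hv : ContinuousOn v (Set.Icc 0 T)) (h0 : u 0 = v 0)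
    (hu' : ∀ t ∈ Set.Icc 0 T, ∀ k, HasDerivWithinAt (fun s => u s k)
      (μ k * u t k + B (u t) (u t) k) (Set.Icc 0 T) t)
    (hv' : ∀ t ∈ Set.Icc 0 T, ∀ k, HasDerivWithinAt (fun s => v s k)
      (μ k * v t k + B (v t) (v t) k) (Set.Icc 0 T) t)
    {t : ℝ} (ht : t ∈ Set.Icc 0 T) : u t = v t := by
  have hμ' : ∀ k, (μ k).re ≤ -(0 : ℝ) := by simpa using hμ
  -- Constant extensions of `u` and `v` beyond `[0, T]` are continuous on all of `ℝ`.
  set U : ℝ → Seq := Set.IccExtend hT ((Set.Icc 0 T).domRestrict u) with hU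
  set V : ℝ → Seq := Set.IccExtend hT ((Set.Icc 0 T).domRestrict v) with hV
  have hUc : Continuous U := hu.domRestrict.Icc_extend'
  have hVc : Continuous V := hv.domRestrict.Icc_extend'
  have hUu : ∀ s ∈ Set.Icc 0 T, U s = u s := fun s hs => Set.IccExtend_of_mem hT _ hs
  have hVv : ∀ s ∈ Set.Icc 0 T, V s = v s := fun s hs => Set.IccExtend_of_mem hT _ hs
  set g : ℝ → Seq := fun s => B (U s) (U s) - B (V s) (V s) with hg
  have hgc : Continuous g := (continuous_quadratic B hUc).sub (continuous_quadratic B hVc)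
  have hw : ∀ t ∈ Set.Icc 0 T, U t - V t = duhamel hμ' g t := fun t ht => Seq.ext fun k => by
    rw [duhamel_apply hμ' le_rfl hgc ht.1]
    have h1 := eq_duhamel_of_hasDerivWithinAt (ν := μ k) (z := fun s => u s k - v s k)
      (g := fun s => g s k) ((Seq.continuous_apply k).comp hgc) (T := T) (fun s hs => by
        refine ((hu' s hs k).sub (hv' s hs k)).congr_deriv ?_
        simp only [hg, hUu s hs, hVv s hs, Seq.sub_apply]
        ring) ht
    rw [Seq.sub_apply, hUu t ht, hVv t ht]
    simpa [h0] using h1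
  obtain ⟨R, hR⟩ := (isCompact_Icc (a := 0) (b := T)).exists_bound_of_continuousOn
    ((hUc.norm.add hVc.norm).continuousOn)
  set W : ℝ → ℝ := fun s => ‖U s - V s‖ with hW
  have hWc : Continuous W := (hUc.sub hVc).norm
  have hle : ∀ t ∈ Set.Icc 0 T, W t ≤ ‖B‖ * R * ∫ s in (0 : ℝ)..t, W s := fun t ht => by
    rw [hW]
    simp only [hw t ht]
    refine (norm_duhamel_le_integral hμ' le_rfl hgc ht.1).trans ?_
    rw [← intervalIntegral.integral_const_mul]
    refine intervalIntegral.integral_mono_on ht.1 (hgc.norm.intervalIntegrable _ _)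
      ((hWc.const_mul _).intervalIntegrable _ _) fun s hs => ?_
    refine (norm_quadratic_sub_le B _ _).trans ?_
    gcongr
    exact (le_abs_self _).trans (hR s ⟨hs.1, hs.2.trans ht.2⟩)
  have hφ : ∀ t, HasDerivAt (fun t => ∫ s in (0 : ℝ)..t, W s) (W t) t := fun t =>
    intervalIntegral.integral_hasDerivAt_right (hWc.intervalIntegrable 0 t)
      (hWc.stronglyMeasurableAtFilter _ _) hWc.continuousAt
  have hφ0 : ∀ t ∈ Set.Icc 0 T, 0 ≤ ∫ s in (0 : ℝ)..t, W s := fun t ht =>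
    intervalIntegral.integral_nonneg ht.1 fun s _ => norm_nonneg _
  have hgr := norm_le_gronwallBound_of_norm_deriv_right_le (δ := 0) (K := ‖B‖ * R) (ε := 0)
    (fun t _ => (hφ t).continuousAt.continuousWithinAt)
    (fun t _ => (hφ t).hasDerivWithinAt) (by simp) (fun t ht => by
      have ht' : t ∈ Set.Icc 0 T := ⟨ht.1, ht.2.le⟩
      rw [add_zero, Real.norm_of_nonneg (norm_nonneg _), Real.norm_of_nonneg (hφ0 t ht')]
      exact hle t ht') t ht
  rw [gronwallBound_ε0, zero_mul, norm_le_zero_iff] at hgr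
  have h2 := hle t ht
  rw [hgr, mul_zero] at h2
  have h3 := norm_le_zero_iff.1 h2
  rwa [hUu t ht, hVv t ht, sub_eq_zero] at h3

end Quadratic

/-! ### Global existence for small data -/

section Existence

variable {ν : ℤ → ℂ} {γ : ℝ} (hν : ∀ k, (ν k).re ≤ -γ) (B : Seq →L[ℂ] Seq →L[ℂ] Seq)

/-- The quadratic term in the equation for `w(t) = e^{γt} u(t)`, where `u` solves
`u' = (ν - γ) u + B(u, u)`. -/
def weightedForcing (γ : ℝ) (w : ℝ → Seq) (s : ℝ) : Seq :=
  (Real.exp (-γ * max s 0) : ℂ) • B (w s) (w s)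

theorem continuous_weightedForcing {w : ℝ → Seq} (hw : Continuous w) :
    Continuous (weightedForcing B γ w) := by
  have := continuous_quadratic B hw
  unfold weightedForcing
  fun_prop

theorem norm_exp_smul_le (hγ : 0 ≤ γ) (s : ℝ) (x : Seq) :
    ‖(Real.exp (-γ * max s 0) : ℂ) • x‖ ≤ ‖x‖ := by
  rw [norm_smul, Complex.norm_real, Real.norm_of_nonneg (Real.exp_pos _).le]
  refine mul_le_of_le_one_left (norm_nonneg _) (Real.exp_le_one_iff.2 ?_)
  have : 0 ≤ γ * max s 0 := by positivity
  linarith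

theorem norm_weightedForcing_le (hγ : 0 ≤ γ) (w : ℝ →ᵇ Seq) (s : ℝ) :
    ‖weightedForcing B γ w s‖ ≤ ‖B‖ * ‖w‖ ^ 2 := by
  refine (norm_exp_smul_le hγ _ _).trans ((norm_quadratic_le B _).trans ?_)
  gcongr
  exact w.norm_coe_le_norm s

theorem norm_weightedForcing_sub_le (hγ : 0 ≤ γ) (w z : ℝ →ᵇ Seq) (s : ℝ) :
    ‖weightedForcing B γ w s - weightedForcing B γ z s‖ ≤
      ‖B‖ * (‖w‖ + ‖z‖) * ‖w - z‖ := by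
  rw [weightedForcing, weightedForcing, ← smul_sub]
  refine (norm_exp_smul_le hγ _ _).trans ((norm_quadratic_sub_le B _ _).trans ?_)
  gcongr
  · exact w.norm_coe_le_norm s
  · exact z.norm_coe_le_norm s
  · exact (w - z).norm_coe_le_norm s

theorem norm_duhamelMap_le (hγ : 0 < γ) (x₀ : Seq) (w : ℝ →ᵇ Seq) (t : ℝ) :
    ‖diagExp ν γ hν t x₀ + duhamel hν (weightedForcing B γ w) (max t 0)‖ ≤
      ‖x₀‖ + ‖B‖ * ‖w‖ ^ 2 / γ := by
  refine (norm_add_le _ _).trans (add_le_add ?_ ?_)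
  · simpa using (diagExp ν γ hν t).le_of_opNorm_le (norm_diagExp_le_one hν hγ.le _) x₀
  · exact norm_duhamel_le hν hγ (norm_weightedForcing_le B hγ.le w) (le_max_right _ _)

/-- The right hand side of Duhamel's formula, as a map on bounded continuous functions of time. -/
def duhamelMap (hγ : 0 < γ) (x₀ : Seq) (w : ℝ →ᵇ Seq) : ℝ →ᵇ Seq :=
  BoundedContinuousFunction.ofNormedAddCommGroup
    (fun t => diagExp ν γ hν t x₀ + duhamel hν (weightedForcing B γ w) (max t 0))
    ((continuous_diagExp_apply hν hγ.le x₀).add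
      ((continuous_duhamel hν hγ.le (continuous_weightedForcing B w.continuous)).comp
        (continuous_id.max continuous_const)))
    (‖x₀‖ + ‖B‖ * ‖w‖ ^ 2 / γ) (norm_duhamelMap_le hν B hγ x₀ w)

theorem norm_duhamelMap_sub_le (hγ : 0 < γ) (x₀ : Seq) (w z : ℝ →ᵇ Seq) :
    ‖duhamelMap hν B hγ x₀ w - duhamelMap hν B hγ x₀ z‖ ≤
      ‖B‖ * (‖w‖ + ‖z‖) / γ * ‖w - z‖ := by
  refine (BoundedContinuousFunction.norm_le (by positivity)).2 fun t => ?_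
  change ‖(diagExp ν γ hν t x₀ + duhamel hν (weightedForcing B γ w) (max t 0)) -
    (diagExp ν γ hν t x₀ + duhamel hν (weightedForcing B γ z) (max t 0))‖ ≤ _
  rw [add_sub_add_left_eq_sub, ← duhamel_sub hν hγ.le (continuous_weightedForcing B w.continuous)
    (continuous_weightedForcing B z.continuous), div_mul_eq_mul_div]
  exact norm_duhamel_le hν hγ (norm_weightedForcing_sub_le B hγ.le w z) (le_max_right _ _)

/-- The smallness of `x₀` makes the map preserve the ball of radius `2‖x₀‖`, on which its Lipschitz
constant is at most `‖B‖ · 4‖x₀‖ / γ ≤ 1 / 2`. -/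
theorem exists_fixedPoint_duhamelMap (hγ : 0 < γ) (x₀ : Seq) (hx₀ : 8 * ‖B‖ * ‖x₀‖ ≤ γ) :
    ∃ w : ℝ →ᵇ Seq, ‖w‖ ≤ 2 * ‖x₀‖ ∧ duhamelMap hν B hγ x₀ w = w := by
  have hmem : ∀ w : ℝ →ᵇ Seq, w ∈ Metric.closedBall (0 : ℝ →ᵇ Seq) (2 * ‖x₀‖) ↔
      ‖w‖ ≤ 2 * ‖x₀‖ := fun w => mem_closedBall_zero_iff
  have hmaps : Set.MapsTo (duhamelMap hν B hγ x₀) (Metric.closedBall 0 (2 * ‖x₀‖))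
      (Metric.closedBall 0 (2 * ‖x₀‖)) := fun w hw => by
    rw [hmem] at hw ⊢
    refine (BoundedContinuousFunction.norm_le (by positivity)).2 fun t =>
      (norm_duhamelMap_le hν B hγ x₀ w t).trans ?_
    have h1 : ‖B‖ * ‖w‖ ^ 2 / γ ≤ ‖x₀‖ := by
      rw [div_le_iff₀ hγ]
      calc ‖B‖ * ‖w‖ ^ 2 ≤ ‖B‖ * (2 * ‖x₀‖) ^ 2 := by gcongr
        _ = ‖x₀‖ * (4 * ‖B‖ * ‖x₀‖) := by ring
        _ ≤ ‖x₀‖ * γ := by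
          gcongr
          have : 0 ≤ ‖B‖ * ‖x₀‖ := by positivity
          linarith
    linarith
  have hcontr : ContractingWith (1 / 2) (hmaps.restrict (duhamelMap hν B hγ x₀) _ _) := by
    refine ⟨by rw [← NNReal.coe_lt_coe]; norm_num, LipschitzWith.of_dist_le_mul ?_⟩
    rintro ⟨w, hw⟩ ⟨z, hz⟩
    rw [hmem] at hw hz
    change dist (duhamelMap hν B hγ x₀ w) (duhamelMap hν B hγ x₀ z) ≤ _ * dist w z
    rw [dist_eq_norm, dist_eq_norm]
    refine (norm_duhamelMap_sub_le hν B hγ x₀ w z).trans ?_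
    gcongr
    rw [div_le_iff₀ hγ]
    calc ‖B‖ * (‖w‖ + ‖z‖) ≤ ‖B‖ * (2 * ‖x₀‖ + 2 * ‖x₀‖) := by gcongr
      _ ≤ _ := by
        push_cast
        linarith
  obtain ⟨w, hw, hfix, -⟩ := hcontr.exists_fixedPoint' Metric.isClosed_closedBall.isComplete
    hmaps (Metric.mem_closedBall_self (by positivity)) (edist_ne_top _ _)
  exact ⟨w, (hmem w).1 hw, hfix⟩

/-- Global existence and exponential decay for `u' = μ u + B(u, u)`, imposed on each mode, when the
semigroup of `μ` decays at rate `2γ` and the initial state is small compared to `γ`. -/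
theorem exists_modes_of_small {μ : ℤ → ℂ} (hμ : ∀ k, (μ k).re ≤ -(2 * γ)) (hγ : 0 < γ)
    (x₀ : Seq) (hx₀ : 8 * ‖B‖ * ‖x₀‖ ≤ γ) :
    ∃ u : ℝ → Seq, Continuous u ∧ u 0 = x₀ ∧
      (∀ t, 0 ≤ t → ‖u t‖ ≤ 2 * ‖x₀‖ * Real.exp (-γ * t)) ∧
      ∀ t, 0 ≤ t → ∀ k, HasDerivWithinAt (fun s => u s k) (μ k * u t k + B (u t) (u t) k)
        (Set.Ici 0) t := by
  have hν : ∀ k, (μ k + γ).re ≤ -γ := fun k => by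
    have := hμ k
    rw [Complex.add_re, Complex.ofReal_re]
    linarith
  obtain ⟨w, hw, hfix⟩ := exists_fixedPoint_duhamelMap hν B hγ x₀ hx₀
  have hwt : ∀ t, w t = diagExp _ γ hν t x₀ + duhamel hν (weightedForcing B γ w) (max t 0) :=
    fun t => congrArg (fun z : ℝ →ᵇ Seq => z t) hfix.symm
  have hfc := continuous_weightedForcing B (γ := γ) w.continuous
  have hwk : ∀ t, 0 ≤ t → ∀ k, w t k = Complex.exp ((μ k + γ) * (t : ℂ)) * x₀ k +
      ∫ s in (0 : ℝ)..t, Complex.exp ((μ k + γ) * ((t - s : ℝ) : ℂ)) *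
        weightedForcing B γ w s k := fun t ht k => by
    rw [hwt, Seq.add_apply, diagExp_apply, max_eq_left ht, duhamel_apply hν hγ.le hfc ht]
  refine ⟨fun t => (Real.exp (-γ * t) : ℂ) • w t, ?_, ?_, fun t _ => ?_, fun t ht k => ?_⟩
  · have := w.continuous
    fun_prop
  · refine Seq.ext fun k => ?_
    rw [Seq.smul_apply, hwk 0 le_rfl]
    simp
  · rw [norm_smul, Complex.norm_real, Real.norm_of_nonneg (Real.exp_pos _).le, mul_comm]
    gcongr
    exact (w.norm_coe_le_norm t).trans hw
  · have h1 := (hasDerivAt_exp_duhamel (x₀ k) (μ k + γ)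
      ((Seq.continuous_apply k).comp hfc) t).hasDerivWithinAt (s := Set.Ici 0)
    have h2 : HasDerivWithinAt (fun s => w s k)
        ((μ k + γ) * w t k + weightedForcing B γ w t k) (Set.Ici 0) t := by
      rw [hwk t ht k]
      exact h1.congr (fun s hs => hwk s hs k) (hwk t ht k)
    have h3 := (hasDerivAt_exp_mul_ofReal (-γ) t).hasDerivWithinAt (s := Set.Ici 0) |>.mul h2
    have hexp : ∀ s : ℝ, Complex.exp (-γ * (s : ℂ)) = (Real.exp (-γ * s) : ℂ) := fun s => by
      push_cast
      rfl
    simp only [Pi.mul_def, hexp] at h3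
    refine h3.congr_deriv ?_
    simp only [weightedForcing, map_smul, _root_.smul_apply, Seq.smul_apply,
      max_eq_left ht]
    ring

end Existence

/-! ### Fourier coefficients of square integrable functions -/

theorem fourierCoeff_sub {f g : Torus → ℂ} (hf : Integrable f (haarAddCircle : Measure Torus))
    (hg : Integrable g (haarAddCircle : Measure Torus)) (k : ℤ) :
    fourierCoeff (f - g) k = fourierCoeff f k - fourierCoeff g k := by
  have h : f - g = f + (-1 : ℂ) • g := by
    rw [neg_one_smul, sub_eq_add_neg]
  rw [h, fourierCoeff.add hf (hg.smul _), Pi.add_apply, fourierCoeff.const_smul]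
  simp [sub_eq_add_neg]

theorem fourierCoeff_conj (f : Torus → ℂ) (k : ℤ) :
    fourierCoeff (fun x => conj (f x)) k = conj (fourierCoeff f (-k)) := by
  rw [fourierCoeff, fourierCoeff, ← integral_conj]
  refine integral_congr_ae (.of_forall fun x => ?_)
  simp

theorem fourierBasis_repr_toLp {f : Torus → ℂ}
    (hf : MemLp f 2 (haarAddCircle : Measure Torus)) (k : ℤ) :
    fourierBasis.repr (hf.toLp f) k = fourierCoeff f k := by
  rw [fourierBasis_repr]
  exact congrFun (fourierCoeff_congr_ae hf.coeFn_toLp) k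

theorem memLp_ofCoeff (u : ℤ → ℂ) : MemLp (ofCoeff u) 2 (haarAddCircle : Measure Torus) := by
  unfold ofCoeff
  split_ifs
  · exact Lp.memLp _
  · exact MemLp.zero

theorem fourierCoeff_ofCoeff {u : ℤ → ℂ} (hu : Memℓp u 2) (k : ℤ) :
    fourierCoeff (ofCoeff u) k = u k := by
  rw [ofCoeff, dif_pos hu, ← fourierBasis_repr, LinearIsometryEquiv.apply_symm_apply]

theorem memLp_fourier_mul {g : Torus → ℂ} (hg : MemLp g 2 (haarAddCircle : Measure Torus)) (k : ℤ) :
    MemLp (fun x => fourier k x * g x) 2 (haarAddCircle : Measure Torus) := by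
  refine hg.of_le_mul (c := 1) ((fourier k).continuous.aestronglyMeasurable.mul hg.1)
    (.of_forall fun x => ?_)
  rw [norm_mul, one_mul]
  exact mul_le_of_le_one_left (norm_nonneg _) (by simp [Circle.norm_coe])

/-- Fourier coefficients of a product are the convolution of the Fourier coefficients: Parseval's
identity for the pair `e_k ḡ`, `h`. -/
theorem hasSum_fourierCoeff_mul {g h : Torus → ℂ}
    (hg : MemLp g 2 (haarAddCircle : Measure Torus))
    (hh : MemLp h 2 (haarAddCircle : Measure Torus)) (k : ℤ) :
    HasSum (fun j => fourierCoeff g j * fourierCoeff h (k - j)) (fourierCoeff (g * h) k) := by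
  have hgc : MemLp (fun x => conj (g x)) 2 (haarAddCircle : Measure Torus) := hg.star
  have hG := memLp_fourier_mul hgc k
  have h1 := fourierBasis.hasSum_inner_mul_inner (hG.toLp _) (hh.toLp _)
  have h2 : inner ℂ (hG.toLp _) (hh.toLp _) = fourierCoeff (g * h) k := by
    rw [L2.inner_def, fourierCoeff]
    refine integral_congr_ae ?_
    filter_upwards [hG.coeFn_toLp, hh.coeFn_toLp] with x hx hx'
    rw [hx, hx', RCLike.inner_apply']
    simp [mul_assoc]
  have h3 : ∀ i, inner ℂ (fourierBasis i) (hh.toLp _) = fourierCoeff h i := fun i => by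
    rw [← fourierBasis.repr_apply_apply, fourierBasis_repr_toLp]
  have h4 : ∀ i, inner ℂ (hG.toLp _) (fourierBasis i) = fourierCoeff g (k - i) := fun i => by
    rw [← inner_conj_symm, ← fourierBasis.repr_apply_apply, fourierBasis_repr_toLp, fourierCoeff,
      fourierCoeff, ← integral_conj]
    refine integral_congr_ae (.of_forall fun x => ?_)
    simp only [smul_eq_mul, map_mul, Complex.conj_conj, ← fourier_neg, ← mul_assoc]
    rw [← fourier_add]
    congr 3
    ring
  rw [h2] at h1
  simp only [h3, h4] at h1
  rw [← (Equiv.subLeft k).hasSum_iff] at h1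
  simpa [Function.comp_def] using h1

/-! ### Real functions on the torus -/

theorem memLp_toC (f : L2) : MemLp (toC f) 2 (haarAddCircle : Measure Torus) := (Lp.memLp f).ofReal

theorem coeff_neg (f : L2) (k : ℤ) : coeff f (-k) = conj (coeff f k) := by
  have h := fourierCoeff_conj (toC f) (-k)
  rw [neg_neg] at h
  rw [coeff, coeff, ← h]
  congr 1
  funext x
  simp [toC]

theorem coeff_sub (f g : L2) (k : ℤ) : coeff (f - g) k = coeff f k - coeff g k := by
  rw [coeff, coeff, coeff, ← fourierCoeff_sub ((memLp_toC f).integrable (by norm_num))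
    ((memLp_toC g).integrable (by norm_num))]
  refine congrFun (fourierCoeff_congr_ae ?_) k
  filter_upwards [Lp.coeFn_sub f g] with x hx
  change (((f - g : L2) x : ℝ) : ℂ) = (f x : ℂ) - (g x : ℂ)
  rw [hx, Pi.sub_apply, Complex.ofReal_sub]

theorem hasSum_norm_coeff_sq (f : L2) : HasSum (fun k => ‖coeff f k‖ ^ 2) (‖f‖ ^ 2) := by
  have h := hasSum_sq_fourierCoeff ((memLp_toC f).toLp _)
  have h1 : ∫ x, ‖(memLp_toC f).toLp (toC f) x‖ ^ 2 ∂(haarAddCircle : Measure Torus) = ‖f‖ ^ 2 := by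
    rw [← real_inner_self_eq_norm_sq, L2.inner_def]
    refine integral_congr_ae ?_
    filter_upwards [(memLp_toC f).coeFn_toLp] with x hx
    rw [hx, real_inner_self_eq_norm_sq]
    simp [toC]
  rw [h1] at h
  rwa [fourierCoeff_congr_ae (memLp_toC f).coeFn_toLp] at h

theorem eq_of_coeff_eq {f g : L2} (h : ∀ k, coeff f k = coeff g k) : f = g := by
  have h1 := hasSum_norm_coeff_sq (f - g)
  simp only [coeff_sub, h, sub_self, norm_zero, ne_eq, OfNat.ofNat_ne_zero, not_false_eq_true,
    zero_pow] at h1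
  have h2 := h1.unique hasSum_zero
  rwa [sq_eq_zero_iff, norm_eq_zero, sub_eq_zero] at h2

theorem coeff_zero_eq_integral (f : L2) :
    coeff f 0 = ((∫ x, f x ∂(haarAddCircle : Measure Torus) : ℝ) : ℂ) := by
  have h : ∫ x, ((f x : ℝ) : ℂ) ∂(haarAddCircle : Measure Torus) =
      ((∫ x, f x ∂(haarAddCircle : Measure Torus) : ℝ) : ℂ) := integral_ofReal
  rw [coeff, fourierCoeff, ← h]
  simp [toC]

/-- Every square summable sequence with the symmetry `u_{-k} = ū_k` is the sequence of Fourier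
coefficients of a real function. -/
theorem exists_coeff_eq {u : ℤ → ℂ} (hu : Memℓp u 2) (hsymm : ∀ k, u (-k) = conj (u k)) :
    ∃ f : L2, ∀ k, coeff f k = u k := by
  have hg := memLp_ofCoeff u
  have hgc : MemLp (fun x => conj (ofCoeff u x)) 2 (haarAddCircle : Measure Torus) := hg.star
  have hre := hg.re
  refine ⟨hre.toLp _, fun k => ?_⟩
  have h1 : coeff (hre.toLp _) k =
      fourierCoeff ((1 / 2 : ℂ) • (ofCoeff u + fun x => conj (ofCoeff u x))) k := by
    refine congrFun (fourierCoeff_congr_ae ?_) k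
    filter_upwards [hre.coeFn_toLp] with x hx
    simp only [toC, hx, Pi.smul_apply, Pi.add_apply, smul_eq_mul, Complex.add_conj]
    simp
  rw [h1, fourierCoeff.const_smul, fourierCoeff.add (hg.integrable (by norm_num))
    (hgc.integrable (by norm_num)), Pi.add_apply, fourierCoeff_conj, fourierCoeff_ofCoeff hu,
    fourierCoeff_ofCoeff hu, hsymm, Complex.conj_conj, smul_eq_mul]
  ring

/-! ### The weight of `H²` -/

/-- The weight `1 + k²`, which turns the norm of `H²` into that of `ℓ²`. -/
def japaneseSq (k : ℤ) : ℝ := 1 + (k : ℝ) ^ 2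

theorem japaneseSq_pos (k : ℤ) : 0 < japaneseSq k := by
  unfold japaneseSq
  positivity

theorem one_le_japaneseSq (k : ℤ) : 1 ≤ japaneseSq k := by
  unfold japaneseSq
  nlinarith [sq_nonneg (k : ℝ)]

theorem japaneseSq_ne_zero (k : ℤ) : (japaneseSq k : ℂ) ≠ 0 :=
  Complex.ofReal_ne_zero.2 (japaneseSq_pos k).ne'

theorem japaneseSq_neg (k : ℤ) : japaneseSq (-k) = japaneseSq k := by
  simp [japaneseSq]

theorem norm_japaneseSq_mul (k : ℤ) (z : ℂ) :
    ‖(japaneseSq k : ℂ) * z‖ ^ 2 = (1 + (k : ℝ) ^ 2) ^ (2 : ℝ) * ‖z‖ ^ 2 := by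
  rw [norm_mul, mul_pow, Complex.norm_real, Real.norm_of_nonneg (japaneseSq_pos k).le,
    Real.rpow_ofNat, japaneseSq]

theorem summable_inv_japaneseSq : Summable fun j : ℤ => (japaneseSq j)⁻¹ := by
  have h1 : Summable fun j : ℤ => 1 / (j : ℝ) ^ 2 := Real.summable_one_div_int_pow.2 one_lt_two
  have h2 : Summable fun j : ℤ => if j = 0 then (1 : ℝ) else 0 :=
    summable_of_hasFiniteSupport ((Set.finite_singleton (0 : ℤ)).subset fun j hj => by
      by_contra h
      simp_all)
  refine (h1.add h2).of_nonneg_of_le (fun j => (inv_pos.2 (japaneseSq_pos j)).le) fun j => ?_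
  rcases eq_or_ne j 0 with rfl | hj
  · simp [japaneseSq]
  · have : (0 : ℝ) < (j : ℝ) ^ 2 := by positivity
    rw [if_neg hj, add_zero, one_div, japaneseSq]
    gcongr
    linarith

/-- The sequence `(1 + |j|) / (1 + j²)`, square summable, by which the convolution kernels are
dominated. -/
def domSeq (j : ℤ) : ℝ := (1 + |(j : ℝ)|) * (japaneseSq j)⁻¹

theorem domSeq_nonneg (j : ℤ) : 0 ≤ domSeq j :=
  mul_nonneg (by positivity) (inv_pos.2 (japaneseSq_pos j)).le

theorem summable_domSeq_sq : Summable fun j => domSeq j ^ 2 := by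
  refine (summable_inv_japaneseSq.mul_left 2).of_nonneg_of_le (fun j => sq_nonneg _) fun j => ?_
  have h := japaneseSq_pos j
  have h1 : (1 + |(j : ℝ)|) ^ 2 ≤ 2 * japaneseSq j := by
    rw [japaneseSq, ← sq_abs (j : ℝ)]
    nlinarith [sq_nonneg (1 - |(j : ℝ)|)]
  rw [domSeq, mul_pow, inv_pow, pow_two (japaneseSq j), mul_inv, ← mul_assoc]
  gcongr
  rwa [← div_eq_mul_inv, div_le_iff₀ h]

theorem abs_mul_inv_japaneseSq_le_domSeq (j : ℤ) : |(j : ℝ)| * (japaneseSq j)⁻¹ ≤ domSeq j := by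
  have := japaneseSq_pos j
  unfold domSeq
  gcongr
  linarith

theorem inv_japaneseSq_le_domSeq (j : ℤ) : (japaneseSq j)⁻¹ ≤ domSeq j := by
  have := japaneseSq_pos j
  refine le_mul_of_one_le_left (by positivity) ?_
  linarith [abs_nonneg (j : ℝ)]

theorem sq_mul_inv_japaneseSq_le_one (j : ℤ) : |(j : ℝ)| ^ 2 * (japaneseSq j)⁻¹ ≤ 1 := by
  rw [← div_eq_mul_inv, div_le_one (japaneseSq_pos j), japaneseSq, sq_abs]
  linarith

theorem abs_mul_inv_japaneseSq_le_one (j : ℤ) : |(j : ℝ)| * (japaneseSq j)⁻¹ ≤ 1 := by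
  rw [← div_eq_mul_inv, div_le_one (japaneseSq_pos j), japaneseSq, ← sq_abs (j : ℝ)]
  nlinarith [sq_nonneg (1 - |(j : ℝ)|), abs_nonneg (j : ℝ)]

/-! ### The quadratic term on the Fourier side -/

/-- A quadratic convolution whose kernel is dominated by `p_j + p_{k-j}`, with `p` square summable,
is square summable: on the part where `p_{k-j} ≤ p_j` the kernel is at most `2 p_j`, and the other
part has this form after the substitution `j ↦ k - j`. -/
theorem memℓp_of_hasSum_convolution {κ : ℤ → ℤ → ℂ} {p : ℤ → ℝ}
    (hκ : ∀ k j, ‖κ k j‖ ≤ p j + p (k - j)) (hp : Summable fun j => p j ^ 2) (x : Seq)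
    {c : ℤ → ℂ} (hc : ∀ k, HasSum (fun j => κ k j * x j * x (k - j)) (c k)) : Memℓp c 2 := by
  classical
  have h0 : ∀ j, 0 ≤ p j := fun j => by
    have := (norm_nonneg _).trans (hκ (j + j) j)
    rw [add_sub_cancel_right] at this
    linarith
  have hp2 : Summable fun j => (2 * p j) ^ 2 := by
    simpa only [mul_pow] using hp.mul_left (2 ^ 2)
  have hκ1 : ∀ j k, ‖if p (k - j) ≤ p j then κ k j else 0‖ ≤ 2 * p j := fun j k => by
    split_ifs with h
    · linarith [hκ k j]
    · simpa using h0 j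
  have hκ2 : ∀ j k, ‖if p j ≤ p (k - j) then 0 else κ k (k - j)‖ ≤ 2 * p j := fun j k => by
    split_ifs with h
    · simpa using h0 j
    · have := hκ k (k - j)
      rw [sub_sub_cancel] at this
      linarith
  have h1 := hasSum_bilin (κ := fun k j => if p (k - j) ≤ p j then κ k j else 0) hκ1 hp2 x x
  have h2 := hasSum_bilin (κ := fun k j => if p j ≤ p (k - j) then 0 else κ k (k - j))
    hκ2 hp2 x x
  have h3 : c = fun k => (bilin _ _ hκ1 hp2 x x + bilin _ _ hκ2 hp2 x x) k := funext fun k => by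
    rw [Seq.add_apply]
    have h4 := (h1 k).add ((Equiv.subLeft k).hasSum_iff.2 (h2 k))
    refine (hc k).unique (h4.congr_fun fun j => ?_)
    simp only [Function.comp_apply, Equiv.subLeft_apply, sub_sub_cancel]
    split_ifs <;> ring
  rw [h3]
  exact lp.memℓp _

theorem norm_symD (k : ℤ) : ‖symD k‖ = |(k : ℝ)| := by
  simp [symD]

theorem norm_symLam (k : ℤ) : ‖symLam k‖ = |(k : ℝ)| := by
  simp [symLam]

/-- The kernel of `2 f_ξ Λf - [Λ, f] f_ξ` on the Fourier side. -/
def quadKernel (k j : ℤ) : ℂ := symD j * (2 * symLam (k - j) - symLam k + symLam j)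

/-- The commutator structure: `||j| - |k|| ≤ |k - j|`, so that only first derivatives remain. -/
theorem norm_quadKernel_le (k j : ℤ) : ‖quadKernel k j‖ ≤ 3 * |(j : ℝ)| * |((k - j : ℤ) : ℝ)| := by
  have h1 : (2 * symLam (k - j) - symLam k + symLam j) =
      ((2 * |((k - j : ℤ) : ℝ)| - |(k : ℝ)| + |(j : ℝ)| : ℝ) : ℂ) := by
    simp [symLam]
  rw [quadKernel, norm_mul, norm_symD, h1, Complex.norm_real, Real.norm_eq_abs, mul_comm 3,
    mul_assoc]
  gcongr
  have h2 := abs_sub_abs_le_abs_sub (k : ℝ) j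
  have h3 := abs_sub_abs_le_abs_sub (j : ℝ) k
  rw [abs_sub_comm (j : ℝ)] at h3
  have h4 := abs_nonneg ((k : ℝ) - j)
  push_cast
  rw [abs_le]
  constructor <;> linarith

section

variable {f : Torus → ℂ} {x : Seq}

theorem memℓp_symbol_mul {m : ℤ → ℂ} (hm : ∀ k, ‖m k‖ ≤ japaneseSq k)
    (hx : ∀ k, x k = japaneseSq k * fourierCoeff f k) :
    Memℓp (fun k => m k * fourierCoeff f k) 2 := by
  refine memℓp_two_iff.2 (x.summable_sq.of_nonneg_of_le (fun k => sq_nonneg _) fun k => ?_)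
  rw [hx, norm_mul, norm_mul, Complex.norm_real, Real.norm_of_nonneg (japaneseSq_pos k).le]
  gcongr
  exact hm k

theorem abs_le_japaneseSq (k : ℤ) : |(k : ℝ)| ≤ japaneseSq k := by
  rw [japaneseSq, ← sq_abs (k : ℝ)]
  nlinarith [sq_nonneg (1 - |(k : ℝ)|)]

theorem sq_abs_le_japaneseSq (k : ℤ) : |(k : ℝ)| * |(k : ℝ)| ≤ japaneseSq k := by
  rw [japaneseSq, ← sq_abs (k : ℝ)]
  linarith [sq_nonneg (|(k : ℝ)|)]

/-- The Fourier coefficients of the quadratic term for `f ∈ H²`. -/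
theorem hasSum_fourierCoeff_nonlin (hf : MemLp f 2 (haarAddCircle : Measure Torus))
    (hx : ∀ k, x k = japaneseSq k * fourierCoeff f k) (k : ℤ) :
    HasSum (fun j => quadKernel k j * fourierCoeff f j * fourierCoeff f (k - j))
      (fourierCoeff (nonlin f) k) := by
  have hD : Memℓp (fun k => symD k * fourierCoeff f k) 2 :=
    memℓp_symbol_mul (fun k => (norm_symD k).trans_le (abs_le_japaneseSq k)) hx
  have hL : Memℓp (fun k => symLam k * fourierCoeff f k) 2 :=
    memℓp_symbol_mul (fun k => (norm_symLam k).trans_le (abs_le_japaneseSq k)) hx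
  have hDc : ∀ k, fourierCoeff (deriv1 f) k = symD k * fourierCoeff f k :=
    fourierCoeff_ofCoeff hD
  have hLc : ∀ k, fourierCoeff (Lam f) k = symLam k * fourierCoeff f k :=
    fourierCoeff_ofCoeff hL
  have hLD : Memℓp (fun k => symLam k * fourierCoeff (deriv1 f) k) 2 := by
    simp only [hDc, ← mul_assoc]
    refine memℓp_symbol_mul (fun k => ?_) hx
    rw [norm_mul, norm_symLam, norm_symD]
    exact sq_abs_le_japaneseSq k
  have hLDc : ∀ k, fourierCoeff (Lam (deriv1 f)) k = symLam k * (symD k * fourierCoeff f k) :=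
    fun k => by rw [← hDc]; exact fourierCoeff_ofCoeff hLD k
  have hDm : MemLp (deriv1 f) 2 (haarAddCircle : Measure Torus) := memLp_ofCoeff _
  have hLm : MemLp (Lam f) 2 (haarAddCircle : Measure Torus) := memLp_ofCoeff _
  have hLDm : MemLp (Lam (deriv1 f)) 2 (haarAddCircle : Measure Torus) := memLp_ofCoeff _
  have hfx : ∀ j, fourierCoeff f j = (japaneseSq j : ℂ)⁻¹ * x j := fun j => by
    rw [hx, inv_mul_cancel_left₀ (japaneseSq_ne_zero j)]
  have s1 := fun k => hasSum_fourierCoeff_mul hDm hf k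
  have s2 := hasSum_fourierCoeff_mul hDm hLm k
  have s3 := hasSum_fourierCoeff_mul hLDm hf k
  simp only [hDc, hLc, hLDc] at s1 s2 s3
  have hLfD : Memℓp (fun k => symLam k * fourierCoeff (deriv1 f * f) k) 2 := by
    refine memℓp_of_hasSum_convolution (p := domSeq) (x := x) (κ := fun k j => symLam k *
      symD j * (japaneseSq j : ℂ)⁻¹ * (japaneseSq (k - j) : ℂ)⁻¹) (fun k j => ?_)
      summable_domSeq_sq fun k => ?_
    · have h1 := abs_mul_inv_japaneseSq_le_domSeq j
      have h2 := inv_japaneseSq_le_domSeq (k - j)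
      have h3 := sq_mul_inv_japaneseSq_le_one j
      have h4 := abs_mul_inv_japaneseSq_le_one (k - j)
      have hj := inv_pos.2 (japaneseSq_pos j)
      have hkj := inv_pos.2 (japaneseSq_pos (k - j))
      rw [norm_mul, norm_mul, norm_mul, norm_symLam, norm_symD, ← Complex.ofReal_inv,
        ← Complex.ofReal_inv, Complex.norm_real, Complex.norm_real, Real.norm_of_nonneg hj.le,
        Real.norm_of_nonneg hkj.le]
      have h5 : |(k : ℝ)| ≤ |(j : ℝ)| + |((k - j : ℤ) : ℝ)| := by
        push_cast
        simpa using abs_add_le (j : ℝ) (k - j)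
      calc |(k : ℝ)| * |(j : ℝ)| * (japaneseSq j)⁻¹ * (japaneseSq (k - j))⁻¹
          ≤ (|(j : ℝ)| + |((k - j : ℤ) : ℝ)|) * |(j : ℝ)| * (japaneseSq j)⁻¹ *
            (japaneseSq (k - j))⁻¹ := by gcongr
        _ = |((k - j : ℤ) : ℝ)| * (japaneseSq (k - j))⁻¹ * (|(j : ℝ)| * (japaneseSq j)⁻¹) +
            |(j : ℝ)| ^ 2 * (japaneseSq j)⁻¹ * (japaneseSq (k - j))⁻¹ := by ring
        _ ≤ 1 * domSeq j + 1 * domSeq (k - j) := by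
          gcongr
        _ = _ := by ring
    · refine ((s1 k).mul_left (symLam k)).congr_fun fun j => ?_
      rw [hfx, hfx]
      ring
  have hLfDc : ∀ k, fourierCoeff (Lam (f * deriv1 f)) k =
      symLam k * fourierCoeff (deriv1 f * f) k := by
    rw [mul_comm f]
    exact fourierCoeff_ofCoeff hLfD
  have hLfDm : MemLp (Lam (f * deriv1 f)) 2 (haarAddCircle : Measure Torus) := memLp_ofCoeff _
  have hi1 : Integrable (deriv1 f * Lam f) (haarAddCircle : Measure Torus) := hDm.integrable_mul hLm
  have hi3 : Integrable (Lam (deriv1 f) * f) (haarAddCircle : Measure Torus) :=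
    hLDm.integrable_mul hf
  have hi2 := hLfDm.integrable (q := 2) (by norm_num)
  rw [nonlin, comm, mul_comm f (Lam (deriv1 f)), fourierCoeff_sub (hi1.smul _) (hi2.sub hi3),
    fourierCoeff_sub hi2 hi3, fourierCoeff.const_smul, hLfDc]
  refine ((s2.const_smul (2 : ℂ)).sub (((s1 k).mul_left (symLam k)).sub s3)).congr_fun fun j => ?_
  simp only [quadKernel, smul_eq_mul]
  ring

end

/-! ### The symbols of the linear part -/

section Symbols

variable {Υ δ β : ℝ}

/-- The common denominator `4(1+Υ|k|)² + δ²k⁴` of the symbols of `a` and `b`; the energy is the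
quadratic form with symbol `symDenom / 4`. -/
def symDenom (Υ δ : ℝ) (k : ℤ) : ℝ := 4 * (1 + Υ * |(k : ℝ)|) ^ 2 + δ ^ 2 * (k : ℝ) ^ 4

theorem symDenom_pos (hΥ : 0 < Υ) (k : ℤ) : 0 < symDenom Υ δ k := by
  unfold symDenom
  positivity

theorem japaneseSq_sq_le_symDenom (hΥ : 0 < Υ) (k : ℤ) :
    min 4 (δ ^ 2) * japaneseSq k ^ 2 ≤ 2 * symDenom Υ δ k := by
  have h1 : japaneseSq k ^ 2 ≤ 2 * (1 + (k : ℝ) ^ 4) := by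
    rw [japaneseSq]
    nlinarith [sq_nonneg (1 - (k : ℝ) ^ 2)]
  have h2 : 1 ≤ (1 + Υ * |(k : ℝ)|) ^ 2 :=
    one_le_pow₀ (le_add_of_nonneg_right (by positivity))
  have h3 : (0 : ℝ) ≤ (k : ℝ) ^ 4 := by positivity
  have h4 : 0 ≤ min 4 (δ ^ 2) := le_min (by norm_num) (sq_nonneg _)
  calc min 4 (δ ^ 2) * japaneseSq k ^ 2 ≤ min 4 (δ ^ 2) * (2 * (1 + (k : ℝ) ^ 4)) := by gcongr
    _ = 2 * (min 4 (δ ^ 2) * 1 + min 4 (δ ^ 2) * (k : ℝ) ^ 4) := by ring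
    _ ≤ 2 * (4 * (1 + Υ * |(k : ℝ)|) ^ 2 + δ ^ 2 * (k : ℝ) ^ 4) := by
      gcongr
      · exact min_le_left _ _
      · exact min_le_right _ _

theorem symDenom_le (hΥ : 0 < Υ) (k : ℤ) :
    symDenom Υ δ k ≤ (4 * (1 + Υ) ^ 2 + δ ^ 2) * japaneseSq k ^ 2 := by
  have h1 : 1 + Υ * |(k : ℝ)| ≤ (1 + Υ) * japaneseSq k := by
    nlinarith [abs_le_japaneseSq k, one_le_japaneseSq k]
  have h2 : (k : ℝ) ^ 4 ≤ japaneseSq k ^ 2 := by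
    rw [japaneseSq]
    nlinarith [sq_nonneg (k : ℝ)]
  calc symDenom Υ δ k ≤ 4 * ((1 + Υ) * japaneseSq k) ^ 2 + δ ^ 2 * japaneseSq k ^ 2 := by
        unfold symDenom
        gcongr
    _ = _ := by ring

theorem one_le_abs_intCast {k : ℤ} (hk : k ≠ 0) : 1 ≤ |(k : ℝ)| := by
  exact_mod_cast Int.one_le_abs hk

theorem symDenom_le_of_ne_zero (hΥ : 0 < Υ) {k : ℤ} (hk : k ≠ 0) :
    symDenom Υ δ k ≤ (4 * (1 + Υ) ^ 2 + δ ^ 2) * (k : ℝ) ^ 4 := by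
  have hk1 := one_le_abs_intCast hk
  have h1 : 1 + Υ * |(k : ℝ)| ≤ (1 + Υ) * |(k : ℝ)| ^ 2 := by
    nlinarith [mul_le_mul_of_nonneg_left hk1 hΥ.le, mul_le_mul_of_nonneg_left
      (le_self_pow₀ hk1 two_ne_zero) hΥ.le, one_le_pow₀ hk1 (n := 2)]
  calc symDenom Υ δ k ≤ 4 * ((1 + Υ) * |(k : ℝ)| ^ 2) ^ 2 + δ ^ 2 * (k : ℝ) ^ 4 := by
        unfold symDenom
        gcongr
    _ = _ := by
      rw [sq_abs]
      ring

theorem symLam_sq (k : ℤ) : symLam k ^ 2 = (k : ℂ) ^ 2 := by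
  rw [symLam, ← Complex.ofReal_pow, sq_abs]
  push_cast
  rfl

theorem symAB_eq (Υ δ : ℝ) (k : ℤ) :
    symAB Υ δ k = (2 * (1 + Υ * symLam k) - Complex.I * (k.sign : ℤ) * (δ * (k : ℂ) ^ 2)) /
      (symDenom Υ δ k : ℂ) := by
  have h : 4 * (1 + Υ * symLam k) ^ 2 - (δ : ℂ) ^ 2 * symLam k ^ 2 * symD k ^ 2 =
      (symDenom Υ δ k : ℂ) := by
    rw [symLam_sq, symD, mul_pow, Complex.I_sq, symDenom, symLam]
    push_cast
    ring
  rw [symAB, symA, symB, h, symHilb, symLam_sq]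
  ring

theorem symLin_eq (Υ δ β : ℝ) (k : ℤ) :
    symLin Υ δ β k = -(δ * symLam k * (k : ℂ) ^ 2) + Complex.I *
      ((1 + Υ * symLam k) * k - β / 4 * symLam k * (k : ℂ) ^ 3 - (k.sign : ℤ)) := by
  have h3 : Complex.I ^ 3 = -Complex.I := Complex.I_pow_three
  rw [symLin, symD, symHilb, mul_pow, mul_pow, Complex.I_sq, h3]
  ring

theorem symLam_neg (k : ℤ) : symLam (-k) = symLam k := by
  simp [symLam]

theorem symAB_neg (k : ℤ) : symAB Υ δ (-k) = conj (symAB Υ δ k) := by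
  have h : symDenom Υ δ (-k) = symDenom Υ δ k := by
    simp [symDenom, Even.neg_pow (by decide : Even 4)]
  rw [symAB_eq, symAB_eq, h, symLam_neg]
  simp only [symLam, Int.cast_neg, Int.sign_neg, map_add, map_sub, map_mul, map_div₀, map_pow,
    map_one, map_ofNat, map_intCast, Complex.conj_ofReal, Complex.conj_I]
  ring

theorem symLin_neg (k : ℤ) : symLin Υ δ β (-k) = conj (symLin Υ δ β k) := by
  rw [symLin_eq, symLin_eq, symLam_neg]
  simp only [symLam, Int.cast_neg, Int.sign_neg, map_add, map_sub, map_neg, map_mul, map_div₀,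
    map_pow, map_one, map_ofNat, map_intCast, Complex.conj_ofReal, Complex.conj_I]
  ring

theorem symLin_zero : symLin Υ δ β 0 = 0 := by
  simp [symLin_eq]

/-- `a + b𝓗` gains two derivatives. -/
theorem norm_japaneseSq_mul_symAB_le (hΥ : 0 < Υ) (hδ : 0 < δ) (k : ℤ) :
    ‖(japaneseSq k : ℂ) * symAB Υ δ k‖ ≤ Real.sqrt (2 / min 4 (δ ^ 2)) := by
  have hD := symDenom_pos (δ := δ) hΥ k
  have hm : 0 < min 4 (δ ^ 2) := lt_min (by norm_num) (by positivity)
  refine Real.le_sqrt_of_sq_le ?_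
  have h1 : 2 * (1 + Υ * symLam k) - Complex.I * (k.sign : ℤ) * (δ * (k : ℂ) ^ 2) =
      ((2 * (1 + Υ * |(k : ℝ)|) : ℝ) : ℂ) +
        ((-((k.sign : ℤ) : ℝ) * (δ * (k : ℝ) ^ 2) : ℝ) : ℂ) * Complex.I := by
    rw [symLam]
    push_cast
    ring
  have h2 : (((k.sign : ℤ) : ℝ)) ^ 2 ≤ 1 := by
    rcases lt_trichotomy k 0 with h | rfl | h
    · simp [Int.sign_eq_neg_one_of_neg h]
    · simp
    · simp [Int.sign_eq_one_of_pos h]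
  have h3 : ‖symAB Υ δ k‖ ^ 2 ≤ 1 / symDenom Υ δ k := by
    rw [symAB_eq, norm_div, div_pow, Complex.norm_real, Real.norm_of_nonneg hD.le, h1,
      ← Complex.normSq_eq_norm_sq, Complex.normSq_add_mul_I, div_le_div_iff₀ (by positivity) hD,
      one_mul, pow_two (symDenom Υ δ k)]
    gcongr
    rw [symDenom]
    have h4 : (0 : ℝ) ≤ (δ * (k : ℝ) ^ 2) ^ 2 := by positivity
    nlinarith
  rw [norm_mul, mul_pow, Complex.norm_real, Real.norm_of_nonneg (japaneseSq_pos k).le]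
  calc japaneseSq k ^ 2 * ‖symAB Υ δ k‖ ^ 2 ≤ japaneseSq k ^ 2 * (1 / symDenom Υ δ k) := by gcongr
    _ ≤ 2 / min 4 (δ ^ 2) := by
      rw [mul_one_div, div_le_div_iff₀ hD hm, mul_comm]
      exact japaneseSq_sq_le_symDenom hΥ k

theorem re_symAB_mul_symLin (Υ δ β : ℝ) (k : ℤ) :
    (symAB Υ δ k * symLin Υ δ β k).re =
      -(δ * (k : ℝ) ^ 2 * ((1 + Υ * |(k : ℝ)|) * |(k : ℝ)| + β / 4 * (k : ℝ) ^ 4 +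
        (k.sign : ℝ) ^ 2)) / symDenom Υ δ k := by
  have hs : ((k.sign : ℤ) : ℝ) * (k : ℝ) = |(k : ℝ)| := by
    exact_mod_cast Int.sign_mul_self_eq_abs k
  have h : symAB Υ δ k * symLin Υ δ β k =
      (((-(2 * (1 + Υ * |(k : ℝ)|) * (δ * |(k : ℝ)| * (k : ℝ) ^ 2)) + (k.sign : ℝ) *
        (δ * (k : ℝ) ^ 2) * ((1 + Υ * |(k : ℝ)|) * k - β / 4 * |(k : ℝ)| * (k : ℝ) ^ 3 -
          (k.sign : ℝ))) / symDenom Υ δ k : ℝ) : ℂ) +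
      (((2 * (1 + Υ * |(k : ℝ)|) * ((1 + Υ * |(k : ℝ)|) * k - β / 4 * |(k : ℝ)| * (k : ℝ) ^ 3 -
          (k.sign : ℝ)) + (k.sign : ℝ) * (δ * (k : ℝ) ^ 2) * (δ * |(k : ℝ)| * (k : ℝ) ^ 2)) /
            symDenom Υ δ k : ℝ) : ℂ) * Complex.I := by
    rw [symAB_eq, symLin_eq, symLam]
    push_cast
    rw [div_mul_eq_mul_div, div_mul_eq_mul_div _ _ Complex.I, ← add_div]
    congr 1
    linear_combination (-(k.sign : ℂ) * (δ * (k : ℂ) ^ 2) * ((1 + Υ * ((|(k : ℝ)| : ℝ) : ℂ)) * k -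
      β / 4 * ((|(k : ℝ)| : ℝ) : ℂ) * (k : ℂ) ^ 3 - k.sign)) * Complex.I_sq
  rw [h, Complex.add_re, Complex.ofReal_re, Complex.re_ofReal_mul, Complex.I_re, mul_zero, add_zero]
  congr 1
  have h4 : (k.sign : ℝ) * (δ * (k : ℝ) ^ 2) * ((1 + Υ * |(k : ℝ)|) * k -
      β / 4 * |(k : ℝ)| * (k : ℝ) ^ 3 - (k.sign : ℝ)) = δ * (k : ℝ) ^ 2 *
      ((1 + Υ * |(k : ℝ)|) * ((k.sign : ℝ) * k) - β / 4 * (|(k : ℝ)| * ((k.sign : ℝ) * k)) *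
        (k : ℝ) ^ 2 - (k.sign : ℝ) ^ 2) := by ring
  rw [h4, hs, ← pow_two, sq_abs]
  ring

/-- The decay rate of the linear part on functions of zero mean. -/
def decayRate (Υ δ β : ℝ) : ℝ := δ * β / 4 / (4 * (1 + Υ) ^ 2 + δ ^ 2)

theorem decayRate_pos (hδ : 0 < δ) (hβ : 0 < β) : 0 < decayRate Υ δ β := by
  unfold decayRate
  positivity

theorem re_symAB_mul_symLin_le (hΥ : 0 < Υ) (hδ : 0 < δ) (hβ : 0 < β) {k : ℤ} (hk : k ≠ 0) :
    (symAB Υ δ k * symLin Υ δ β k).re ≤ -decayRate Υ δ β := by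
  have hD := symDenom_pos (δ := δ) hΥ k
  rw [re_symAB_mul_symLin, neg_div, neg_le_neg_iff, decayRate, div_le_div_iff₀ (by positivity) hD]
  have hk1 : 1 ≤ (k : ℝ) ^ 2 := by
    rw [← sq_abs]
    exact one_le_pow₀ (one_le_abs_intCast hk)
  have h1 : β / 4 * (k : ℝ) ^ 4 ≤ (1 + Υ * |(k : ℝ)|) * |(k : ℝ)| + β / 4 * (k : ℝ) ^ 4 +
      (k.sign : ℝ) ^ 2 := by
    have : 0 ≤ (1 + Υ * |(k : ℝ)|) * |(k : ℝ)| := by positivity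
    nlinarith [sq_nonneg (k.sign : ℝ)]
  calc δ * β / 4 * symDenom Υ δ k
      ≤ δ * β / 4 * ((4 * (1 + Υ) ^ 2 + δ ^ 2) * (k : ℝ) ^ 4) := by
        gcongr
        exact symDenom_le_of_ne_zero hΥ hk
    _ = δ * 1 * (β / 4 * (k : ℝ) ^ 4) * (4 * (1 + Υ) ^ 2 + δ ^ 2) := by ring
    _ ≤ _ := by gcongr

end Symbols

/-! ### The energy -/

section Energy

variable {f : L2}

theorem summable_japaneseSq_sq (hf : MemH 2 f) :
    Summable fun k => japaneseSq k ^ 2 * ‖coeff f k‖ ^ 2 := by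
  simpa only [MemH, Real.rpow_ofNat, japaneseSq] using hf

theorem normH_two_sq (f : L2) : normH 2 f ^ 2 = ∑' k, japaneseSq k ^ 2 * ‖coeff f k‖ ^ 2 := by
  rw [normH, Real.sq_sqrt (tsum_nonneg fun k => by positivity)]
  simp only [Real.rpow_ofNat, japaneseSq]

theorem seminormH_sq {s : ℝ} {n : ℕ} (hs : 2 * s = n) (hn : n ≠ 0) (f : L2) :
    seminormH s f ^ 2 = ∑' k : ℤ, |(k : ℝ)| ^ n * ‖coeff f k‖ ^ 2 := by
  rw [seminormH, Real.sq_sqrt (tsum_nonneg fun k => by split_ifs <;> positivity)]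
  refine tsum_congr fun k => ?_
  split_ifs with hk
  · simp [hk, hn]
  · rw [hs, Real.rpow_natCast]

theorem hasSum_seminormH_sq (hf : MemH 2 f) {s : ℝ} {n : ℕ} (hs : 2 * s = n) (hn : n ≠ 0)
    (hle : ∀ k : ℤ, |(k : ℝ)| ^ n ≤ japaneseSq k ^ 2) :
    HasSum (fun k : ℤ => |(k : ℝ)| ^ n * ‖coeff f k‖ ^ 2) (seminormH s f ^ 2) := by
  rw [seminormH_sq hs hn]
  refine ((summable_japaneseSq_sq hf).of_nonneg_of_le (fun k => by positivity) fun k => ?_).hasSum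
  gcongr
  exact hle k

theorem hasSum_energy (Υ δ : ℝ) (hf : MemH 2 f) :
    HasSum (fun k => symDenom Υ δ k / 4 * ‖coeff f k‖ ^ 2) (energy Υ δ f) := by
  have hJ : ∀ k, japaneseSq k ≤ japaneseSq k ^ 2 := fun k =>
    le_self_pow₀ (one_le_japaneseSq k) two_ne_zero
  have h1 := hasSum_seminormH_sq hf (s := 1 / 2) (n := 1) (by norm_num) one_ne_zero fun k => by
    rw [pow_one]
    exact (abs_le_japaneseSq k).trans (hJ k)
  have h2 := hasSum_seminormH_sq hf (s := 1) (n := 2) (by norm_num) two_ne_zero fun k => by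
    rw [pow_two]
    exact (sq_abs_le_japaneseSq k).trans (hJ k)
  have h4 := hasSum_seminormH_sq hf (s := 2) (n := 4) (by norm_num) four_ne_zero fun k => by
    rw [show |(k : ℝ)| ^ 4 = (|(k : ℝ)| * |(k : ℝ)|) ^ 2 by ring]
    exact pow_le_pow_left₀ (by positivity) (sq_abs_le_japaneseSq k) 2
  refine ((((hasSum_norm_coeff_sq f).add (h1.mul_left (2 * Υ))).add (h2.mul_left (Υ ^ 2))).add
    (h4.mul_left (δ ^ 2 / 4))).congr_fun fun k => ?_
  have h5 : |(k : ℝ)| ^ 4 = (k : ℝ) ^ 4 := by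
    rw [← abs_pow, abs_of_nonneg (by positivity)]
  rw [symDenom, h5]
  ring

theorem le_energy {Υ : ℝ} (hΥ : 0 < Υ) (δ : ℝ) (hf : MemH 2 f) :
    min 4 (δ ^ 2) / 8 * normH 2 f ^ 2 ≤ energy Υ δ f := by
  rw [normH_two_sq, ← tsum_mul_left]
  refine hasSum_le (fun k => ?_) ((summable_japaneseSq_sq hf).mul_left _).hasSum
    (hasSum_energy Υ δ hf)
  rw [← mul_assoc]
  gcongr
  linarith [japaneseSq_sq_le_symDenom (δ := δ) hΥ k]

theorem energy_le {Υ : ℝ} (hΥ : 0 < Υ) (δ : ℝ) (hf : MemH 2 f) :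
    energy Υ δ f ≤ (4 * (1 + Υ) ^ 2 + δ ^ 2) / 4 * normH 2 f ^ 2 := by
  rw [normH_two_sq, ← tsum_mul_left]
  refine hasSum_le (fun k => ?_) (hasSum_energy Υ δ hf)
    ((summable_japaneseSq_sq hf).mul_left _).hasSum
  rw [← mul_assoc]
  gcongr
  linarith [symDenom_le (δ := δ) hΥ k]

end Energy

/-! ### The quadratic map on `ℓ²(ℤ)` -/

section StateKernel

variable {Υ δ : ℝ}

/-- The kernel of `-(a + b𝓗)(2 f_ξ Λf - [Λ, f] f_ξ)` in the unknowns `x_k = (1 + k²) f̂(k)`. -/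
def stateKernel (Υ δ : ℝ) (k j : ℤ) : ℂ :=
  -((japaneseSq k : ℂ) * symAB Υ δ k) * quadKernel k j *
    ((japaneseSq j : ℂ)⁻¹ * (japaneseSq (k - j) : ℂ)⁻¹)

theorem norm_stateKernel_le (hΥ : 0 < Υ) (hδ : 0 < δ) (j k : ℤ) :
    ‖stateKernel Υ δ k j‖ ≤ 3 * Real.sqrt (2 / min 4 (δ ^ 2)) * domSeq j := by
  have hj := inv_pos.2 (japaneseSq_pos j)
  have hkj := inv_pos.2 (japaneseSq_pos (k - j))
  have h1 := norm_japaneseSq_mul_symAB_le hΥ hδ k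
  have h2 := norm_quadKernel_le k j
  have h3 := abs_mul_inv_japaneseSq_le_domSeq j
  have h4 := abs_mul_inv_japaneseSq_le_one (k - j)
  have h5 := domSeq_nonneg j
  rw [stateKernel, norm_mul, norm_mul, norm_mul, norm_neg, ← Complex.ofReal_inv,
    ← Complex.ofReal_inv, Complex.norm_real, Complex.norm_real, Real.norm_of_nonneg hj.le,
    Real.norm_of_nonneg hkj.le]
  calc _ ≤ Real.sqrt (2 / min 4 (δ ^ 2)) * (3 * |(j : ℝ)| * |((k - j : ℤ) : ℝ)|) *
        ((japaneseSq j)⁻¹ * (japaneseSq (k - j))⁻¹) := by gcongr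
    _ = 3 * Real.sqrt (2 / min 4 (δ ^ 2)) * (|(j : ℝ)| * (japaneseSq j)⁻¹) *
        (|((k - j : ℤ) : ℝ)| * (japaneseSq (k - j))⁻¹) := by ring
    _ ≤ 3 * Real.sqrt (2 / min 4 (δ ^ 2)) * domSeq j * 1 := by gcongr
    _ = _ := mul_one _

theorem exists_hasSum_stateKernel (hΥ : 0 < Υ) (hδ : 0 < δ) :
    ∃ B : Seq →L[ℂ] Seq →L[ℂ] Seq, ∀ x k,
      HasSum (fun j => stateKernel Υ δ k j * x j * x (k - j)) (B x x k) :=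
  ⟨bilin _ _ (norm_stateKernel_le hΥ hδ) (by
    simpa only [mul_pow] using summable_domSeq_sq.mul_left _), fun x k => hasSum_bilin _ _ x x k⟩

theorem quadKernel_neg (k j : ℤ) : quadKernel (-k) (-j) = conj (quadKernel k j) := by
  have h : -k - -j = -(k - j) := by ring
  rw [quadKernel, quadKernel, h, symLam_neg, symLam_neg, symLam_neg]
  simp only [symD, symLam, Int.cast_neg, map_add, map_sub, map_mul, map_ofNat, map_intCast,
    Complex.conj_ofReal, Complex.conj_I]
  ring

theorem stateKernel_neg (k j : ℤ) : stateKernel Υ δ (-k) (-j) = conj (stateKernel Υ δ k j) := by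
  have h : -k - -j = -(k - j) := by ring
  rw [stateKernel, stateKernel, quadKernel_neg, symAB_neg, h, japaneseSq_neg, japaneseSq_neg,
    japaneseSq_neg]
  simp

theorem stateKernel_zero_neg (j : ℤ) : stateKernel Υ δ 0 (-j) = -stateKernel Υ δ 0 j := by
  have h1 : (0 : ℤ) - -j = j := by ring
  rw [stateKernel, stateKernel, quadKernel, quadKernel, h1, zero_sub, japaneseSq_neg, symLam_neg]
  simp only [symD, Int.cast_neg]
  ring

variable {B : Seq →L[ℂ] Seq →L[ℂ] Seq}

/-- Conservation of the mean: the kernel of the zeroth mode is odd. -/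
theorem quadratic_apply_zero
    (hB : ∀ x k, HasSum (fun j => stateKernel Υ δ k j * x j * x (k - j)) (B x x k))
    (x : Seq) : B x x 0 = 0 := by
  have h1 := hB x 0
  have h2 := (Equiv.neg ℤ).hasSum_iff.2 h1
  have h3 := h1.neg.unique (h2.congr_fun fun j => by
    simp only [Function.comp_apply, Equiv.neg_apply, stateKernel_zero_neg, zero_sub, neg_neg]
    ring)
  exact self_eq_neg.1 h3.symm

theorem quadratic_conj
    (hB : ∀ x k, HasSum (fun j => stateKernel Υ δ k j * x j * x (k - j)) (B x x k))
    {x y : Seq} (hy : ∀ k, y k = conj (x (-k))) (k : ℤ) :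
    B y y k = conj (B x x (-k)) := by
  have h1 := (Complex.hasSum_conj'.2 ((Equiv.neg ℤ).hasSum_iff.2 (hB x (-k))))
  refine (hB y k).unique (h1.congr_fun fun j => ?_)
  have h : -k - -j = -(k - j) := by ring
  simp only [Function.comp_apply, Equiv.neg_apply, map_mul, stateKernel_neg, Complex.conj_conj, hy,
    h]

theorem quadratic_eq_nonlin
    (hB : ∀ x k, HasSum (fun j => stateKernel Υ δ k j * x j * x (k - j)) (B x x k))
    {f : Torus → ℂ} (hf : MemLp f 2 (haarAddCircle : Measure Torus))
    {x : Seq} (hx : ∀ k, x k = japaneseSq k * fourierCoeff f k) (k : ℤ) :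
    B x x k = -((japaneseSq k : ℂ) * (symAB Υ δ k * fourierCoeff (nonlin f) k)) := by
  have h1 := (hasSum_fourierCoeff_nonlin hf hx k).mul_left (-((japaneseSq k : ℂ) * symAB Υ δ k))
  refine ((hB x k).unique (h1.congr_fun fun j => ?_)).trans (by ring)
  have h2 := japaneseSq_ne_zero j
  have h3 := japaneseSq_ne_zero (k - j)
  rw [stateKernel, hx, hx]
  field_simp

end StateKernel

/-! ### Functions in `H²` as states -/

open Classical in
/-- The state `x_k = (1 + k²) f̂(k)` in `ℓ²(ℤ)` of a function `f ∈ H²` (and `0` if `f ∉ H²`). -/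
def state (f : L2) : Seq :=
  if h : Summable fun k => ‖(japaneseSq k : ℂ) * coeff f k‖ ^ 2 then Seq.mk _ h else 0

theorem memH_two_iff {f : L2} :
    MemH 2 f ↔ Summable fun k => ‖(japaneseSq k : ℂ) * coeff f k‖ ^ 2 := by
  simp only [MemH, norm_japaneseSq_mul]

theorem state_apply {f : L2} (hf : MemH 2 f) (k : ℤ) :
    state f k = japaneseSq k * coeff f k := by
  rw [state, dif_pos (memH_two_iff.1 hf), Seq.mk_apply]

theorem coeff_eq_state {f : L2} (hf : MemH 2 f) (k : ℤ) :
    coeff f k = (japaneseSq k : ℂ)⁻¹ * state f k := by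
  rw [state_apply hf, inv_mul_cancel_left₀ (japaneseSq_ne_zero k)]

theorem normH_two_eq_norm {f : L2} {x : Seq} (h : ∀ k, x k = japaneseSq k * coeff f k) :
    normH 2 f = ‖x‖ := by
  rw [normH, ← Real.sqrt_sq (norm_nonneg x), Seq.norm_sq]
  simp only [h, norm_japaneseSq_mul]

theorem normH_two_eq_norm_state {f : L2} (hf : MemH 2 f) : normH 2 f = ‖state f‖ :=
  normH_two_eq_norm (state_apply hf)

theorem normH_two_sub {f g : L2} (hf : MemH 2 f) (hg : MemH 2 g) :
    normH 2 (f - g) = ‖state f - state g‖ :=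
  normH_two_eq_norm fun k => by
    rw [Seq.sub_apply, state_apply hf, state_apply hg, coeff_sub, mul_sub]

theorem state_neg {f : L2} (hf : MemH 2 f) (k : ℤ) : state f (-k) = conj (state f k) := by
  rw [state_apply hf, state_apply hf, coeff_neg, japaneseSq_neg]
  simp

theorem eq_of_state_eq {f g : L2} (hf : MemH 2 f) (hg : MemH 2 g) (h : state f = state g) :
    f = g :=
  eq_of_coeff_eq fun k => by rw [coeff_eq_state hf, coeff_eq_state hg, h]

/-- A state with the symmetry `x_{-k} = x̄_k` comes from a real function in `H²`. -/
theorem exists_state_eq {x : Seq} (hx : ∀ k, x (-k) = conj (x k)) :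
    ∃ f : L2, MemH 2 f ∧ state f = x := by
  obtain ⟨f, hf⟩ := exists_coeff_eq (u := fun k => (japaneseSq k : ℂ)⁻¹ * x k)
    (memℓp_two_iff.2 (x.summable_sq.of_nonneg_of_le (fun k => sq_nonneg _) fun k => by
      rw [norm_mul, norm_inv, Complex.norm_real, Real.norm_of_nonneg (japaneseSq_pos k).le]
      have h := inv_pos.2 (japaneseSq_pos k)
      gcongr
      refine mul_le_of_le_one_left (norm_nonneg (x k)) ?_
      exact inv_le_one_of_one_le₀ (one_le_japaneseSq k)))
    fun k => by
      rw [japaneseSq_neg, hx]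
      simp
  have h : ∀ k, (japaneseSq k : ℂ) * coeff f k = x k := fun k => by
    rw [hf, mul_inv_cancel_left₀ (japaneseSq_ne_zero k)]
  have hmem : MemH 2 f := memH_two_iff.2 (by simpa only [h] using x.summable_sq)
  exact ⟨f, hmem, Seq.ext fun k => by rw [state_apply hmem, h]⟩

/-! ### Reflection of states -/

/-- The state `k ↦ conj x_{-k}` of the complex conjugate function. -/
def reflect (x : Seq) : Seq :=
  Seq.mk (fun k => conj (x (-k))) (by
    simpa [Function.comp_def] using (Equiv.neg ℤ).summable_iff.2 x.summable_sq)

theorem reflect_apply (x : Seq) (k : ℤ) : reflect x k = conj (x (-k)) := rfl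

theorem isometry_reflect : Isometry reflect := by
  refine Isometry.of_dist_eq fun x y => ?_
  have h : ‖reflect x - reflect y‖ ^ 2 = ‖x - y‖ ^ 2 := by
    rw [Seq.norm_sq, Seq.norm_sq, ← (Equiv.neg ℤ).tsum_eq fun k => ‖(x - y) k‖ ^ 2]
    refine tsum_congr fun k => ?_
    rw [Equiv.neg_apply, Seq.sub_apply, Seq.sub_apply, reflect_apply, reflect_apply, ← map_sub,
      RCLike.norm_conj]
  rw [dist_eq_norm, dist_eq_norm]
  exact (pow_left_inj₀ (norm_nonneg _) (norm_nonneg _) two_ne_zero).1 h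

/-! ### The evolution equation on states -/

section Evolution

variable {Υ δ β ε : ℝ} {B : Seq →L[ℂ] Seq →L[ℂ] Seq}

/-- The symbol of the linear part of the equation. -/
def linSymbol (Υ δ β ε : ℝ) (k : ℤ) : ℂ := (ε : ℂ)⁻¹ * (symAB Υ δ k * symLin Υ δ β k)

theorem linSymbol_neg (k : ℤ) : linSymbol Υ δ β ε (-k) = conj (linSymbol Υ δ β ε k) := by
  rw [linSymbol, linSymbol, symAB_neg, symLin_neg]
  simp

theorem linSymbol_zero : linSymbol Υ δ β ε 0 = 0 := by
  rw [linSymbol, symLin_zero, mul_zero, mul_zero]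

theorem re_linSymbol_le (hΥ : 0 < Υ) (hδ : 0 < δ) (hβ : 0 < β) (hε : 0 < ε) {k : ℤ} (hk : k ≠ 0) :
    (linSymbol Υ δ β ε k).re ≤ -(decayRate Υ δ β / ε) := by
  rw [linSymbol, ← Complex.ofReal_inv, Complex.re_ofReal_mul, div_eq_inv_mul, ← mul_neg]
  have := inv_pos.2 hε
  gcongr
  exact re_symAB_mul_symLin_le hΥ hδ hβ hk

theorem re_linSymbol_nonpos (hΥ : 0 < Υ) (hδ : 0 < δ) (hβ : 0 < β) (hε : 0 < ε) (k : ℤ) :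
    (linSymbol Υ δ β ε k).re ≤ 0 := by
  rcases eq_or_ne k 0 with rfl | hk
  · rw [linSymbol_zero, Complex.zero_re]
  · have h := div_pos (decayRate_pos (Υ := Υ) hδ hβ) hε
    linarith [re_linSymbol_le hΥ hδ hβ hε hk]

theorem japaneseSq_mul_rhsCoeff
    (hB : ∀ x k, HasSum (fun j => stateKernel Υ δ k j * x j * x (k - j)) (B x x k))
    {f : L2} (hf : MemH 2 f) (k : ℤ) :
    (japaneseSq k : ℂ) * rhsCoeff Υ δ β ε f k =
      linSymbol Υ δ β ε k * state f k + B (state f) (state f) k := by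
  rw [quadratic_eq_nonlin hB (memLp_toC f) (state_apply hf), rhsCoeff, linSymbol, state_apply hf]
  ring

theorem ContH2On.continuousOn_state {I : Set ℝ} {F : ℝ → L2} (hF : ContH2On I F) :
    ContinuousOn (fun τ => state (F τ)) I := fun τ₀ hτ₀ => by
  rw [ContinuousWithinAt, tendsto_iff_norm_sub_tendsto_zero]
  refine (hF.2 τ₀ hτ₀).congr' ?_
  filter_upwards [self_mem_nhdsWithin] with τ hτ
  exact normH_two_sub (hF.1 τ hτ) (hF.1 τ₀ hτ₀)

theorem IsSolution.hasDerivWithinAt_state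
    (hB : ∀ x k, HasSum (fun j => stateKernel Υ δ k j * x j * x (k - j)) (B x x k))
    {I : Set ℝ} {F₀ : L2} {F : ℝ → L2} (hF : IsSolution Υ δ β ε I F₀ F) {τ : ℝ} (hτ : τ ∈ I)
    (k : ℤ) : HasDerivWithinAt (fun σ => state (F σ) k)
      (linSymbol Υ δ β ε k * state (F τ) k + B (state (F τ)) (state (F τ)) k) I τ := by
  rw [← japaneseSq_mul_rhsCoeff hB (hF.cont.1 τ hτ)]
  exact ((hF.eqn τ hτ k).const_mul _).congr (fun σ hσ => state_apply (hF.cont.1 σ hσ) k)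
    (state_apply (hF.cont.1 τ hτ) k)

/-- Solutions of the equation on `[0, T]` are unique. -/
theorem IsSolution.unique (hΥ : 0 < Υ) (hδ : 0 < δ) (hβ : 0 < β) (hε : 0 < ε) {T : ℝ} (hT : 0 ≤ T)
    {F₀ : L2} {F G : ℝ → L2} (hF : IsSolution Υ δ β ε (Set.Icc 0 T) F₀ F)
    (hG : IsSolution Υ δ β ε (Set.Icc 0 T) F₀ G) {τ : ℝ} (hτ : τ ∈ Set.Icc 0 T) : G τ = F τ := by
  obtain ⟨B, hB⟩ := exists_hasSum_stateKernel hΥ hδ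
  refine eq_of_state_eq (hG.cont.1 τ hτ) (hF.cont.1 τ hτ) ?_
  exact eq_of_modes B (re_linSymbol_nonpos hΥ hδ hβ hε) hT hG.cont.continuousOn_state
    hF.cont.continuousOn_state (by rw [hF.init, hG.init])
    (fun t ht k => hG.hasDerivWithinAt_state hB ht k)
    (fun t ht k => hF.hasDerivWithinAt_state hB ht k) hτ

theorem IsSolution.mono {I J : Set ℝ} (hJI : J ⊆ I) {F₀ : L2} {F : ℝ → L2}
    (hF : IsSolution Υ δ β ε I F₀ F) : IsSolution Υ δ β ε J F₀ F where
  cont := ⟨fun τ hτ => hF.cont.1 τ (hJI hτ),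
    fun τ hτ => (hF.cont.2 τ (hJI hτ)).mono_left (nhdsWithin_mono τ hJI)⟩
  init := hF.init
  eqn τ hτ k := (hF.eqn τ (hJI hτ) k).mono hJI

/-- A continuous curve of states that solves the equation on each mode and starts from the state of
a real function comes from a solution of the equation. -/
theorem exists_isSolution_of_modes (hΥ : 0 < Υ) (hδ : 0 < δ) (hβ : 0 < β) (hε : 0 < ε)
    (hB : ∀ x k, HasSum (fun j => stateKernel Υ δ k j * x j * x (k - j)) (B x x k))
    {F₀ : L2} (hF₀ : MemH 2 F₀) {u : ℝ → Seq} (hu : Continuous u) (hu0 : u 0 = state F₀)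
    (hu' : ∀ t, 0 ≤ t → ∀ k, HasDerivWithinAt (fun s => u s k)
      (linSymbol Υ δ β ε k * u t k + B (u t) (u t) k) (Set.Ici 0) t) :
    ∃ F : ℝ → L2, IsSolution Υ δ β ε (Set.Ici 0) F₀ F ∧ ∀ t, 0 ≤ t → state (F t) = u t := by
  -- The reflected curve solves the same equation, so that `u` is real by uniqueness.
  have hreal : ∀ t, 0 ≤ t → ∀ k, u t (-k) = conj (u t k) := fun t ht k => by
    have h := eq_of_modes B (re_linSymbol_nonpos hΥ hδ hβ hε) ht (u := fun s => reflect (u s))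
      (v := u) (isometry_reflect.continuous.comp hu).continuousOn hu.continuousOn
      (Seq.ext fun k => by
        rw [reflect_apply, hu0, state_neg hF₀, Complex.conj_conj])
      (fun s hs k => by
        have h1 := (hu' s hs.1 (-k)).star.mono (Set.Icc_subset_Ici_self : Set.Icc 0 t ⊆ Set.Ici 0)
        refine h1.congr_deriv ?_
        rw [quadratic_conj hB (reflect_apply (u s)), reflect_apply, linSymbol_neg]
        simp)
      (fun s hs k => (hu' s hs.1 k).mono Set.Icc_subset_Ici_self) (Set.right_mem_Icc.2 ht)
    have h2 := reflect_apply (u t) (-k)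
    rwa [h, neg_neg] at h2
  have hex : ∀ t, ∃ f : L2, 0 ≤ t → MemH 2 f ∧ state f = u t := fun t => by
    by_cases ht : 0 ≤ t
    · obtain ⟨f, hf⟩ := exists_state_eq (hreal t ht)
      exact ⟨f, fun _ => hf⟩
    · exact ⟨0, fun h => absurd h ht⟩
  choose F hF using hex
  have hmem : ∀ t ∈ Set.Ici (0 : ℝ), MemH 2 (F t) := fun t ht => (hF t ht).1
  have hst : ∀ t ∈ Set.Ici (0 : ℝ), state (F t) = u t := fun t ht => (hF t ht).2
  refine ⟨F, ⟨⟨hmem, fun τ₀ hτ₀ => ?_⟩, ?_, fun τ hτ k => ?_⟩, hst⟩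
  · have h1 : Tendsto (fun τ => ‖u τ - u τ₀‖) (𝓝[Set.Ici 0] τ₀) (𝓝 0) :=
      (tendsto_iff_norm_sub_tendsto_zero.1 (hu.tendsto τ₀)).mono_left nhdsWithin_le_nhds
    refine h1.congr' ?_
    filter_upwards [self_mem_nhdsWithin] with τ hτ
    rw [normH_two_sub (hmem τ hτ) (hmem τ₀ hτ₀), hst τ hτ, hst τ₀ hτ₀]
  · have h0 : (0 : ℝ) ∈ Set.Ici (0 : ℝ) := Set.self_mem_Ici
    exact eq_of_state_eq (hmem 0 h0) hF₀ ((hst 0 h0).trans hu0)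
  · have h1 := (hu' τ hτ k).const_mul ((japaneseSq k : ℂ)⁻¹)
    rw [← hst τ hτ, ← japaneseSq_mul_rhsCoeff hB (hmem τ hτ),
      inv_mul_cancel_left₀ (japaneseSq_ne_zero k)] at h1
    exact h1.congr (fun σ hσ => by rw [coeff_eq_state (hmem σ hσ), hst σ hσ])
      (by rw [coeff_eq_state (hmem τ hτ), hst τ hτ])

/-- Global existence for small data of zero mean, with exponential decay in `H²`. -/
theorem exists_isSolution_of_small (hΥ : 0 < Υ) (hδ : 0 < δ) (hβ : 0 < β) (hε : 0 < ε)
    (hB : ∀ x k, HasSum (fun j => stateKernel Υ δ k j * x j * x (k - j)) (B x x k))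
    {F₀ : L2} (hF₀ : MemH 2 F₀) (hmean : MeanZero F₀)
    (hsmall : 16 * ‖B‖ * (ε * normH 2 F₀) ≤ decayRate Υ δ β) :
    ∃ F : ℝ → L2, IsSolution Υ δ β ε (Set.Ici 0) F₀ F ∧ ∀ t, 0 ≤ t →
      normH 2 (F t) ≤ 2 * normH 2 F₀ * Real.exp (-(decayRate Υ δ β / ε / 2) * t) := by
  have hc := div_pos (decayRate_pos (Υ := Υ) hδ hβ) hε
  -- The zeroth mode carries no dynamics and is damped artificially.
  set μ : ℤ → ℂ := fun k =>
    if k = 0 then ((-(decayRate Υ δ β / ε) : ℝ) : ℂ) else linSymbol Υ δ β ε k with hμ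
  have hμre : ∀ k, (μ k).re ≤ -(2 * (decayRate Υ δ β / ε / 2)) := fun k => by
    rw [mul_div_cancel₀ _ (two_ne_zero' ℝ), hμ]
    dsimp only
    split_ifs with hk
    · rw [Complex.ofReal_re]
    · exact re_linSymbol_le hΥ hδ hβ hε hk
  obtain ⟨u, huc, hu0, hudecay, hu'⟩ := exists_modes_of_small B hμre (half_pos hc) (state F₀) (by
    rw [normH_two_eq_norm_state hF₀] at hsmall
    rw [div_div, le_div_iff₀ (by positivity)]
    linarith)
  have hzero : ∀ t, 0 ≤ t → u t 0 = 0 := fun t ht => by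
    have h1 := eq_duhamel_of_hasDerivWithinAt (ν := μ 0) (z := fun s => u s 0) (g := fun _ => 0)
      continuous_const (T := t) (fun s hs => by
        have h2 := (hu' s hs.1 0).mono (Set.Icc_subset_Ici_self : Set.Icc 0 t ⊆ Set.Ici 0)
        rwa [quadratic_apply_zero hB] at h2) (Set.right_mem_Icc.2 ht)
    have h3 : u 0 0 = 0 := by
      rw [hu0, state_apply hF₀, coeff_zero_eq_integral, hmean]
      simp
    simpa [h3] using h1
  obtain ⟨F, hF, hFu⟩ := exists_isSolution_of_modes hΥ hδ hβ hε hB hF₀ huc hu0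
    fun t ht k => (hu' t ht k).congr_deriv (by
      rcases eq_or_ne k 0 with rfl | hk
      · rw [hzero t ht, mul_zero, mul_zero]
      · rw [hμ]
        dsimp only
        rw [if_neg hk])
  refine ⟨F, hF, fun t ht => ?_⟩
  rw [normH_two_eq_norm_state (hF.cont.1 t ht), hFu t ht, normH_two_eq_norm_state hF₀]
  exact hudecay t ht

end Evolution

end HydroUni

end

theorem theorem6p2 (Υ δ β : ℝ) (hΥ : 0 < Υ) (hδ : 0 < δ) (hβ : 0 < β) :
    ∃ εstar c C m M : ℝ, 0 < εstar ∧ 0 < c ∧ 0 < C ∧ 0 < m ∧ 0 < M ∧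
      -- the energy is comparable to the square of the norm of `H²`
      (∀ f : HydroUni.L2, HydroUni.MemH 2 f →
        m * HydroUni.normH 2 f ^ 2 ≤ HydroUni.energy Υ δ f ∧
          HydroUni.energy Υ δ f ≤ M * HydroUni.normH 2 f ^ 2) ∧
      ∀ ε : ℝ, 0 < ε → ∀ F₀ : HydroUni.L2, HydroUni.MemH 2 F₀ → HydroUni.MeanZero F₀ →
        ε * HydroUni.normH 2 F₀ ≤ εstar →
        ∃ F : ℝ → HydroUni.L2,
          HydroUni.IsSolution Υ δ β ε (Set.Ici 0) F₀ F ∧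
          -- every solution on a bounded time interval is a restriction of `F`
          (∀ T : ℝ, 0 < T → ∀ G : ℝ → HydroUni.L2,
            HydroUni.IsSolution Υ δ β ε (Set.Icc 0 T) F₀ G → ∀ τ ∈ Set.Icc 0 T, G τ = F τ) ∧
          ∀ τ : ℝ, 0 ≤ τ →
            HydroUni.energy Υ δ (F τ) ≤
              C * HydroUni.energy Υ δ F₀ * Real.exp (-(c / ε) * τ) := by
  obtain ⟨B, hB⟩ := HydroUni.exists_hasSum_stateKernel hΥ hδ
  have hc := HydroUni.decayRate_pos (Υ := Υ) hδ hβ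
  set c := HydroUni.decayRate Υ δ β with hcdef
  set m := min 4 (δ ^ 2) / 8 with hm
  set M := (4 * (1 + Υ) ^ 2 + δ ^ 2) / 4 with hM
  have hm0 : 0 < m := by
    have : 0 < min 4 (δ ^ 2) := lt_min (by norm_num) (by positivity)
    positivity
  have hM0 : 0 < M := by positivity
  refine ⟨c / (16 * (‖B‖ + 1)), c, 4 * M / m, m, M, by positivity, hc, by positivity, hm0, hM0,
    fun f hf => ⟨HydroUni.le_energy hΥ δ hf, HydroUni.energy_le hΥ δ hf⟩,
    fun ε hε F₀ hF₀ hmean hsmall => ?_⟩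
  obtain ⟨F, hF, hdecay⟩ := HydroUni.exists_isSolution_of_small hΥ hδ hβ hε hB hF₀ hmean (by
    rw [le_div_iff₀ (by positivity)] at hsmall
    have h0 : 0 ≤ ε * HydroUni.normH 2 F₀ := mul_nonneg hε.le (Real.sqrt_nonneg _)
    linarith)
  refine ⟨F, hF, fun T hT G hG τ hτ =>
    (hF.mono Set.Icc_subset_Ici_self).unique hΥ hδ hβ hε hT.le hG hτ, fun τ hτ => ?_⟩
  calc HydroUni.energy Υ δ (F τ) ≤ M * HydroUni.normH 2 (F τ) ^ 2 :=
        HydroUni.energy_le hΥ δ (hF.cont.1 τ hτ)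
    _ ≤ M * (2 * HydroUni.normH 2 F₀ * Real.exp (-(c / ε / 2) * τ)) ^ 2 := by
        gcongr
        · exact Real.sqrt_nonneg _
        · exact hdecay τ hτ
    _ = 4 * M / m * (m * HydroUni.normH 2 F₀ ^ 2) * Real.exp (-(c / ε) * τ) := by
        rw [mul_pow, ← Real.exp_nat_mul]
        have h1 : ((2 : ℕ) : ℝ) * (-(c / ε / 2) * τ) = -(c / ε) * τ := by
          push_cast
          ring
        rw [h1]
        field_simp
        ring
    _ ≤ 4 * M / m * HydroUni.energy Υ δ F₀ * Real.exp (-(c / ε) * τ) := by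
        gcongr
        exact HydroUni.le_energy hΥ δ hF₀
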